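/- \textbf{Setting.} Fix $p\ge 1$, a compact set $\mathcal X\subset\mathbb R^p$ and $\tau\in(0,1)$. Let $(X_i^H,Y_i^H)_{i\ge1}$ (high fidelity, HF) and $(X_j^L,Y_j^L)_{j\ge1}$ (low fidelity, LF) be two i.i.d. sequences in $\mathcal X\times\mathbb R$, independent of each other. For $\bullet\in\{H,L\}$ let $F^\bullet(y\mid x)$ be the conditional CDF of $Y^\bullet$ given $X^\bullet=x$ (for a fixed regular conditional distribution), let $Q^\bullet(v\mid x)=\inf\{y:F^\bullet(y\mid x)\ge v\}$, and let $q_\tau(x)=Q^H(\tau\mid x)$. Let $F^U(\cdot\mid x)$ be the conditional CDF of $U=F^L(Y^H\mid X^H)$ given $X^H=x$. For $\beta\in(0,1]$, $g\in\mathcal H(\beta,C)$ means $|g(x)-g(x')|\le C\|x-x'\|^\beta$ for all $x,x'\in\mathcal X$. \textbf{Assumptions.} There are a function $u_\tau:\mathcal X\to(0,1)$, compact intervals $\mathcal Y\subset\mathbb R$ and $\mathcal U^L\subset(0,1)$, exponents $\beta_q,\beta_u,\beta_L\in(0,1]$ and finite constants $c_H,c_L,c_U,c_X,c_{\mathcal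 X},h_0>0$, $C_X,C_q,C_q^F,C_u,C_u^F,C_L$ such that: (1) (local quantile link) $Q^H(\tau\mid x)=Q^L(u_\tau(x)\mid x)$ for all $x\in\mathcal X$. (2) (regularity) For all $x\in\mathcal X$: $q_\tau(x)$ lies in the interior of $\mathcal Y$ and $u_\tau(x)$ in the interior of $\mathcal U^L$; the conditional distributions of $Y^H$ and $Y^L$ given $X=x$ are supported in $\mathcal Y$; $F^H(\cdot\mid x)$ and $F^L(\cdot\mid x)$ are $C^1$ on $\mathcal Y$ with derivatives at least $c_H$ and $c_L$ there, respectively; $Q^L(\cdot\mid x)$ is $C^2$ on $\mathcal U^L$. (3) (smoothness) $q_\tau\in\mathcal H(\beta_q,C_q)$ and $F^H(y\mid\cdot)\in\mathcal H(\beta_q,C_q^F)$ for all $y\in\mathcal Y$; $u_\tau\in\mathcal H(\beta_u,C_u)$ and $F^U(v\mid\cdot)\in\mathcal H(\beta_u,C_u^F)$ for all $v\in\mathcal U^L$; for all $x\in\mathcal X$, $F^U(\cdot\mid x)$ is $C^1$ on $\mathcal U^L$ with derivative at least $c_U$; $F^L(y\mid\cdot)\in\mathcal H(\beta_L,C_L)$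 for all $y\in\mathcal Y$. (4) (design) $X^H$ and $X^L$ have Lebesgue densities on $\mathcal X$ with values in $[c_X,C_X]$, and $\int_{\mathcal X}h^{-p}K((t-x)/h)\,dt\ge c_{\mathcal X}$ for all $0<h<h_0$ and $x\in\mathcal X$, where $K$ is the kernel in (5). (5) (kernel) $K:\mathbb R^p\to\mathbb R$ is bounded, Lipschitz, compactly supported and nonnegative, with $\int K=1$ and $\int K^2<\infty$. \textbf{Estimators.} Write $K_h(z)=h^{-p}K(z/h)$, let $n_H,n_L$ be the sample sizes, let $h_q,h_u,h_L>0$ be bandwidths, and put $$\hat F^L(y\mid x)=\sum_{j=1}^{n_L}\frac{K_{h_L}(X_j^L-x)}{\sum_{\ell=1}^{n_L}K_{h_L}(X_\ell^L-x)}\mathbf 1\{Y_j^L\le y\},\qquad \hat U_i=\hat F^L(Y_i^H\mid X_i^H),$$ $$\hat u_\tau(x)=\inf\Bigl\{v:\sum_{i=1}^{n_H}\frac{K_{h_u}(X_i^H-x)}{\sum_{\ell=1}^{n_H}K_{h_u}(X_\ell^H-x)}\mathbf 1\{\hat U_i\le v\}\ge\tau\Bigr\}.$$ The kernel wrapper estimator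 is $\tilde q_\tau(x)=\inf\{y:\hat F^L(y\mid x)\ge\hat u_\tau(x)\}$. The direct kernel HF estimator $\hat q_\tau^H(x)$ is defined as $\hat u_\tau(x)$, with $\hat U_i$ replaced by $Y_i^H$ and $h_u$ by $h_q$. \textbf{Claim.} Let $n_H\to\infty$ and $n_L\to\infty$ along an arbitrary sequence of pairs, with $$h_q\asymp n_H^{-1/(2\beta_q+p)},\qquad h_u\asymp n_H^{-1/(2\beta_u+p)},\qquad h_L\asymp\Bigl(\frac{\log n_L}{n_L}\Bigr)^{1/(2\beta_L+p)}.$$ Then, for every fixed $x\in\mathcal X$, $$\hat q_\tau^H(x)-q_\tau(x)=O_p\bigl(n_H^{-\beta_q/(2\beta_q+p)}\bigr),$$ $$\tilde q_\tau(x)-q_\tau(x)=O_p\Bigl(n_H^{-\beta_u/(2\beta_u+p)}+\Bigl(\frac{\log n_L}{n_L}\Bigr)^{\beta_L/(2\beta_L+p)}\Bigr).$$ -/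

import Mathlib

open MeasureTheory ProbabilityTheory Filter Asymptotics Set
open scoped Topology

noncomputable section

namespace MFQR

/-- The covariate space `ℝ^p` with its Euclidean norm. -/
abbrev Cov (p : ℕ) : Type := EuclideanSpace ℝ (Fin p)

/-- Generalized inverse `v ↦ inf {y : F y ≥ v}` of a distribution function. -/
def genInv (F : ℝ → ℝ) (v : ℝ) : ℝ := sInf {y | v ≤ F y}

/-- Conditional CDF `F(y ∣ x)` of a response with regular conditional law `κ`. -/
def condDF {p : ℕ} (κ : Kernel (Cov p) ℝ) (x : Cov p) (y : ℝ) : ℝ := cdf (κ x) y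

/-- Conditional quantile `Q(v ∣ x) = inf {y : F(y ∣ x) ≥ v}`. -/
def condQuantile {p : ℕ} (κ : Kernel (Cov p) ℝ) (x : Cov p) (v : ℝ) : ℝ :=
  genInv (condDF κ x) v

/-- `F^U(u ∣ x)`: conditional CDF, given `X = x`, of the wrapped response `U = F^L(Y^H ∣ X)`. -/
def wrappedDF {p : ℕ} (κH κL : Kernel (Cov p) ℝ) (x : Cov p) (u : ℝ) : ℝ :=
  cdf ((κH x).map (fun y => condDF κL x y)) u

/-- Hölder class `H(β, C)` on `𝒳`, for exponents `β ∈ (0, 1]`. -/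
def HolderClass {p : ℕ} (𝒳 : Set (Cov p)) (β C : ℝ) (f : Cov p → ℝ) : Prop :=
  ∀ x ∈ 𝒳, ∀ x' ∈ 𝒳, |f x - f x'| ≤ C * ‖x - x'‖ ^ β

/-- `F` is `C¹` on the interval `I`, with derivative there at least `c`. -/
def C1WithDensityGE (F : ℝ → ℝ) (I : Set ℝ) (c : ℝ) : Prop :=
  ContDiffOn ℝ 1 F I ∧ ∀ y ∈ I, c ≤ derivWithin F I y

/-- Local quantile link: on `𝒳` the HF `τ`-quantile is the LF quantile at level `u x ∈ (0, 1)`. -/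
def LocalQuantileLink {p : ℕ} (𝒳 : Set (Cov p)) (τ : ℝ) (κH κL : Kernel (Cov p) ℝ)
    (u : Cov p → ℝ) : Prop :=
  ∀ x ∈ 𝒳, u x ∈ Ioo (0 : ℝ) 1 ∧ condQuantile κH x τ = condQuantile κL x (u x)

/-- Standing regularity assumption, with `𝒴 = [a, b]` and `𝒰^L = [ul, ur] ⊂ (0, 1)`. -/
structure Regularity {p : ℕ} (𝒳 : Set (Cov p)) (τ : ℝ) (κH κL : Kernel (Cov p) ℝ)
    (u : Cov p → ℝ) (a b ul ur : ℝ) : Prop where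
  compact : IsCompact 𝒳
  levels : Icc ul ur ⊆ Ioo (0 : ℝ) 1
  quantile_mem : ∀ x ∈ 𝒳, condQuantile κH x τ ∈ interior (Icc a b)
  level_mem : ∀ x ∈ 𝒳, u x ∈ interior (Icc ul ur)
  supp_H : ∀ x ∈ 𝒳, κH x (Icc a b)ᶜ = 0
  supp_L : ∀ x ∈ 𝒳, κL x (Icc a b)ᶜ = 0
  density_H : ∃ c > 0, ∀ x ∈ 𝒳, C1WithDensityGE (condDF κH x) (Icc a b) c
  density_L : ∃ c > 0, ∀ x ∈ 𝒳, C1WithDensityGE (condDF κL x) (Icc a b) c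
  quantile_L : ∀ x ∈ 𝒳, ContDiffOn ℝ 2 (condQuantile κL x) (Icc ul ur)

/-- Hölder conditions on the targets and conditional CDFs, and regularity of `F^U`. -/
structure Smoothness {p : ℕ} (𝒳 : Set (Cov p)) (τ : ℝ) (κH κL : Kernel (Cov p) ℝ)
    (u : Cov p → ℝ) (a b ul ur βq βu βL : ℝ) : Prop where
  target_H : ∃ C, HolderClass 𝒳 βq C (fun x => condQuantile κH x τ)
  cdf_H : ∃ C, ∀ y ∈ Icc a b, HolderClass 𝒳 βq C (fun x => condDF κH x y)
  target_U : ∃ C, HolderClass 𝒳 βu C u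
  cdf_U : ∃ C, ∀ v ∈ Icc ul ur, HolderClass 𝒳 βu C (fun x => wrappedDF κH κL x v)
  density_U : ∃ c > 0, ∀ x ∈ 𝒳, C1WithDensityGE (wrappedDF κH κL x) (Icc ul ur) c
  cdf_L : ∃ C, ∀ y ∈ Icc a b, HolderClass 𝒳 βL C (fun x => condDF κL x y)

/-- Rescaled kernel `K_h(z) = h^{-p} K(z / h)`. -/
def scaled {p : ℕ} (K : Cov p → ℝ) (h : ℝ) (z : Cov p) : ℝ := (h ^ p)⁻¹ * K (h⁻¹ • z)

/-- Conditions on the smoothing kernel. -/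
structure KernelConditions {p : ℕ} (K : Cov p → ℝ) : Prop where
  nonneg : ∀ z, 0 ≤ K z
  bounded : ∃ B, ∀ z, K z ≤ B
  lipschitz : ∃ L, LipschitzWith L K
  compactSupport : HasCompactSupport K
  integral_one : ∫ z, K z = 1
  sq_integrable : Integrable (fun z => K z ^ 2)

/-- Kernel-mass condition: `∫_𝒳 K_h(t - x) dt` is bounded below, uniformly in `x ∈ 𝒳` and small
`h`. -/
def KernelMass {p : ℕ} (𝒳 : Set (Cov p)) (K : Cov p → ℝ) : Prop :=
  ∃ h₀ > 0, ∃ c > 0, ∀ h ∈ Ioo (0 : ℝ) h₀, ∀ x ∈ 𝒳, c ≤ ∫ t in 𝒳, scaled K h (t - x)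

/-- The covariate distribution on `𝒳` with Lebesgue density `f`. -/
def designLaw {p : ℕ} (𝒳 : Set (Cov p)) (f : Cov p → ℝ) : Measure (Cov p) :=
  (volume.restrict 𝒳).withDensity (fun t => ENNReal.ofReal (f t))

/-- `f` is measurable, and bounded above and away from zero on `𝒳`. -/
def DensityBounds {p : ℕ} (𝒳 : Set (Cov p)) (f : Cov p → ℝ) : Prop :=
  Measurable f ∧ ∃ c > 0, ∃ C, ∀ x ∈ 𝒳, c ≤ f x ∧ f x ≤ C

/-- `(X_i, Y_i)` are i.i.d.; `X_i` has law `μ` and `Y_i` has conditional law `κ` given `X_i`. -/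
structure IsIIDSample {Ω : Type*} [MeasurableSpace Ω] (P : Measure Ω) {p : ℕ}
    (X : ℕ → Ω → Cov p) (Y : ℕ → Ω → ℝ) (μ : Measure (Cov p)) (κ : Kernel (Cov p) ℝ) : Prop where
  measurable_X : ∀ i, Measurable (X i)
  measurable_Y : ∀ i, Measurable (Y i)
  law : ∀ i, P.map (fun ω => (X i ω, Y i ω)) = μ ⊗ₘ κ
  indep : iIndepFun (fun i ω => (X i ω, Y i ω)) P

/-- Nadaraya–Watson estimator `∑_{i<n} w_i(x) 1{z_i ≤ z}` of a conditional CDF, with weights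
`w_i(x) = K_h(x_i - x) / ∑_{l<n} K_h(x_l - x)`, from the data `(x_i, z_i)`, `i < n`. -/
def nwCDF {p : ℕ} (K : Cov p → ℝ) (h : ℝ) (n : ℕ) (X : ℕ → Cov p) (Z : ℕ → ℝ) (x : Cov p)
    (z : ℝ) : ℝ :=
  ∑ i ∈ Finset.range n,
    scaled K h (X i - x) / (∑ l ∈ Finset.range n, scaled K h (X l - x)) *
      (Iic z).indicator (fun _ => (1 : ℝ)) (Z i)

/-- Local constant kernel quantile estimator. -/
def kernelQuantile {p : ℕ} (K : Cov p → ℝ) (h : ℝ) (n : ℕ) (X : ℕ → Cov p) (Z : ℕ → ℝ) (τ : ℝ)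
    (x : Cov p) : ℝ :=
  genInv (nwCDF K h n X Z x) τ

/-- Kernel wrapper estimator: wrap the HF responses by the LF CDF estimator, estimate the level
by the kernel quantile estimator, and map back by the inverse of the LF CDF estimator. -/
def wrapperEstimator {p : ℕ} (K : Cov p → ℝ) (hu hL : ℝ) (nH nL : ℕ)
    (XH : ℕ → Cov p) (YH : ℕ → ℝ) (XL : ℕ → Cov p) (YL : ℕ → ℝ) (τ : ℝ) (x : Cov p) : ℝ :=
  genInv (nwCDF K hL nL XL YL x)
    (kernelQuantile K hu nH XH (fun i => nwCDF K hL nL XL YL (XH i) (YH i)) τ x)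

/-- `Z_k = O_p(r_k)` as `k → ∞`. -/
def IsBigOp {Ω : Type*} [MeasurableSpace Ω] (P : Measure Ω) (Z : ℕ → Ω → ℝ) (r : ℕ → ℝ) : Prop :=
  ∀ ε > 0, ∃ M > 0, ∀ᶠ k in atTop, P.real {ω | M * r k < |Z k ω|} ≤ ε

end MFQR

end

namespace MFQR

/-! ### Generalized inverses and Nadaraya–Watson distribution functions -/

/-! Both estimators invert weighted empirical distribution functions. By monotonicity such an
inverse lies in `[z₁, z₂]` as soon as the function is below the level at `z₁` and at least the level
at `z₂` (`genInv_nwCDF_mem_Icc`). After clearing the random denominator, each comparison concerns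
the sign of an i.i.d. kernel-weighted sum.

At distance `M * ρ` from the target, the density lower bound moves the conditional mean by order `M
* ρ`, while the Hölder bias over the kernel's support is `O(r)` with `r ≤ ρ`. For large `M` a
negative drift of order `ρ` remains, and a Bernstein–Chernoff bound gives failure probability
`exp(-c n h^p ρ²)` (`IsIIDSample.exists_kernel_tail`). The bandwidth keeps `n h^p r²` bounded below,
so enlarging `M` makes this as small as desired (`IsIIDSample.exists_level_margin`). The direct rate
is the case `ρ = r`.

For the wrapper, the quantile link gives `F^U(u(x) ∣ x) = τ`, so `û` is the direct estimator applied
to estimated instead of true responses `F^L(Y ∣ X)`. Uniform convergence of the LF estimator is not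
needed. At each fixed point its error exceeds `M₁ * s` with probability at most `2 / nL²`; this is
what the logarithm in `s` buys (`IsIIDSample.exists_nwCDF_tail`). Since the LF sample is independent
of the HF sample, Fubini and Markov show that HF points with a larger error carry kernel weight
below any fixed multiple of `nH * ρ`, with probability tending to one
(`exists_wrapped_error_weight_le`). The drift margin absorbs these points; the others only shift the
threshold by `M₁ * s`. Finally the LF estimator is controlled at the two points `q ± M * ρ`, and the
density of `F^L` turns the level error into a quantile error. -/

theorem scaled_nonneg {p : ℕ} {K : Cov p → ℝ} (hK : ∀ z, 0 ≤ K z) {h : ℝ} (hh : 0 < h)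
    (z : Cov p) : 0 ≤ scaled K h z :=
  mul_nonneg (by positivity) (hK _)

theorem nwCDF_eq_div {p : ℕ} (K : Cov p → ℝ) (h : ℝ) (n : ℕ) (X : ℕ → Cov p) (Z : ℕ → ℝ)
    (x : Cov p) (z : ℝ) :
    nwCDF K h n X Z x z =
      (∑ i ∈ Finset.range n, scaled K h (X i - x) * (Iic z).indicator (fun _ => (1 : ℝ)) (Z i)) /
        ∑ i ∈ Finset.range n, scaled K h (X i - x) := by
  rw [nwCDF, Finset.sum_div]
  exact Finset.sum_congr rfl fun i _ => by ring

section Deterministic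

variable {p : ℕ} {K : Cov p → ℝ} {h : ℝ} {n : ℕ} {X : ℕ → Cov p} {Z : ℕ → ℝ} {x : Cov p}

theorem indicator_Iic_mono {z z' : ℝ} (hz : z ≤ z') (w : ℝ) :
    (Iic z).indicator (fun _ => (1 : ℝ)) w ≤ (Iic z').indicator (fun _ => (1 : ℝ)) w :=
  indicator_le_indicator_of_subset (Iic_subset_Iic.2 hz) (fun _ => zero_le_one) w

theorem indicator_Iic_nonneg (z w : ℝ) : 0 ≤ (Iic z).indicator (fun _ => (1 : ℝ)) w :=
  indicator_nonneg (fun _ _ => zero_le_one) w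

theorem indicator_Iic_le_one (z w : ℝ) : (Iic z).indicator (fun _ => (1 : ℝ)) w ≤ 1 :=
  indicator_le_self' (fun _ _ => zero_le_one) w

theorem nwCDF_mono (hK : ∀ z, 0 ≤ K z) (hh : 0 < h) : Monotone (nwCDF K h n X Z x) := by
  intro z z' hz
  refine Finset.sum_le_sum fun i _ => mul_le_mul_of_nonneg_left (indicator_Iic_mono hz _) ?_
  exact div_nonneg (scaled_nonneg hK hh _) (Finset.sum_nonneg fun i _ => scaled_nonneg hK hh _)

/-- Below the smallest response every indicator vanishes. This makes superlevel sets at positive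
levels bounded below, so that `sInf` is a genuine infimum. -/
theorem exists_nwCDF_eq_zero : ∃ z₀, ∀ z < z₀, nwCDF K h n X Z x z = 0 := by
  obtain ⟨z₀, hz₀⟩ := ((Finset.range n).image Z).bddBelow
  refine ⟨z₀, fun z hz => Finset.sum_eq_zero fun i hi => ?_⟩
  have : z₀ ≤ Z i := hz₀ (Finset.mem_coe.2 (Finset.mem_image_of_mem Z hi))
  rw [indicator_of_notMem (by simp only [mem_Iic, not_le]; linarith), mul_zero]

/-- A strictly negative sum already rules out a vanishing denominator, since nonnegative weights
with zero total are all zero. No separate event is therefore needed to control the denominator. -/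
theorem lt_nwCDF_of_sum_neg (hK : ∀ z, 0 ≤ K z) (hh : 0 < h) {θ z : ℝ}
    (hs : ∑ i ∈ Finset.range n,
      scaled K h (X i - x) * (θ - (Iic z).indicator (fun _ => (1 : ℝ)) (Z i)) < 0) :
    θ < nwCDF K h n X Z x z := by
  have hS : 0 ≤ ∑ i ∈ Finset.range n, scaled K h (X i - x) :=
    Finset.sum_nonneg fun i _ => scaled_nonneg hK hh _
  rcases hS.eq_or_lt with h0 | hpos
  · have h0' := (Finset.sum_eq_zero_iff_of_nonneg fun i _ => scaled_nonneg hK hh _).1 h0.symm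
    rw [Finset.sum_eq_zero fun i hi => by rw [h0' i hi, zero_mul]] at hs
    exact absurd hs (lt_irrefl _)
  · rw [nwCDF_eq_div, lt_div_iff₀ hpos, Finset.mul_sum]
    simp only [mul_sub, Finset.sum_sub_distrib] at hs
    simp only [mul_comm θ]
    linarith

theorem nwCDF_lt_of_sum_neg (hK : ∀ z, 0 ≤ K z) (hh : 0 < h) {θ z : ℝ}
    (hs : ∑ i ∈ Finset.range n,
      scaled K h (X i - x) * ((Iic z).indicator (fun _ => (1 : ℝ)) (Z i) - θ) < 0) :
    nwCDF K h n X Z x z < θ := by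
  have hS : 0 ≤ ∑ i ∈ Finset.range n, scaled K h (X i - x) :=
    Finset.sum_nonneg fun i _ => scaled_nonneg hK hh _
  rcases hS.eq_or_lt with h0 | hpos
  · have h0' := (Finset.sum_eq_zero_iff_of_nonneg fun i _ => scaled_nonneg hK hh _).1 h0.symm
    rw [Finset.sum_eq_zero fun i hi => by rw [h0' i hi, zero_mul]] at hs
    exact absurd hs (lt_irrefl _)
  · rw [nwCDF_eq_div, div_lt_iff₀ hpos, Finset.mul_sum]
    simp only [mul_sub, Finset.sum_sub_distrib] at hs
    simp only [mul_comm θ]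
    linarith

theorem genInv_nwCDF_mem_Icc (hK : ∀ z, 0 ≤ K z) (hh : 0 < h) {v z₁ z₂ : ℝ} (hv : 0 < v)
    (h₁ : nwCDF K h n X Z x z₁ < v) (h₂ : v ≤ nwCDF K h n X Z x z₂) :
    genInv (nwCDF K h n X Z x) v ∈ Icc z₁ z₂ := by
  obtain ⟨z₀, hz₀⟩ := exists_nwCDF_eq_zero (K := K) (h := h) (n := n) (X := X) (Z := Z) (x := x)
  constructor
  · refine le_csInf ⟨z₂, h₂⟩ fun z hz => ?_
    by_contra! hlt
    exact absurd (nwCDF_mono hK hh hlt.le : nwCDF K h n X Z x z ≤ _)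
      (not_le.2 (h₁.trans_le hz))
  · refine csInf_le ⟨z₀, fun z hz => ?_⟩ h₂
    by_contra! hlt
    rw [mem_ofPred_eq, hz₀ z hlt] at hz
    exact absurd hz (not_le.2 hv)

/-- Replacing the responses `Z i` by surrogates `Z' i` changes the weighted empirical distribution
function at a shifted argument by at most the weight of the indices where they differ by more
than the shift. -/
theorem sum_neg_of_perturb_upper (hK : ∀ z, 0 ≤ K z) (hh : 0 < h) {Z' : ℕ → ℝ} {τ w η A : ℝ}
    (hs : ∑ i ∈ Finset.range n,
      scaled K h (X i - x) * (τ - (Iic w).indicator (fun _ => (1 : ℝ)) (Z i)) < -A)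
    (hb : ∑ i ∈ Finset.range n,
      scaled K h (X i - x) * (Ioi η).indicator (fun _ => (1 : ℝ)) |Z' i - Z i| ≤ A) :
    ∑ i ∈ Finset.range n,
      scaled K h (X i - x) * (τ - (Iic (w + η)).indicator (fun _ => (1 : ℝ)) (Z' i)) < 0 := by
  have : ∑ i ∈ Finset.range n,
      scaled K h (X i - x) * (τ - (Iic (w + η)).indicator (fun _ => (1 : ℝ)) (Z' i)) ≤
      ∑ i ∈ Finset.range n,
        (scaled K h (X i - x) * (τ - (Iic w).indicator (fun _ => (1 : ℝ)) (Z i)) +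
        scaled K h (X i - x) * (Ioi η).indicator (fun _ => (1 : ℝ)) |Z' i - Z i|) := by
    -- Termwise this is `1{Z i ≤ w} ≤ 1{Z' i ≤ w + η} + 1{|Z' i - Z i| > η}`.
    refine Finset.sum_le_sum fun i _ => ?_
    rw [← mul_add]
    refine mul_le_mul_of_nonneg_left ?_ (scaled_nonneg hK hh _)
    simp only [indicator_apply, mem_Iic, mem_Ioi]
    have := le_abs_self (Z' i - Z i)
    split_ifs <;> linarith
  rw [Finset.sum_add_distrib] at this
  linarith

theorem sum_neg_of_perturb_lower (hK : ∀ z, 0 ≤ K z) (hh : 0 < h) {Z' : ℕ → ℝ} {τ w η A : ℝ}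
    (hs : ∑ i ∈ Finset.range n,
      scaled K h (X i - x) * ((Iic w).indicator (fun _ => (1 : ℝ)) (Z i) - τ) < -A)
    (hb : ∑ i ∈ Finset.range n,
      scaled K h (X i - x) * (Ioi η).indicator (fun _ => (1 : ℝ)) |Z' i - Z i| ≤ A) :
    ∑ i ∈ Finset.range n,
      scaled K h (X i - x) * ((Iic (w - η)).indicator (fun _ => (1 : ℝ)) (Z' i) - τ) < 0 := by
  have : ∑ i ∈ Finset.range n,
      scaled K h (X i - x) * ((Iic (w - η)).indicator (fun _ => (1 : ℝ)) (Z' i) - τ) ≤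
      ∑ i ∈ Finset.range n,
        (scaled K h (X i - x) * ((Iic w).indicator (fun _ => (1 : ℝ)) (Z i) - τ) +
        scaled K h (X i - x) * (Ioi η).indicator (fun _ => (1 : ℝ)) |Z' i - Z i|) := by
    refine Finset.sum_le_sum fun i _ => ?_
    rw [← mul_add]
    refine mul_le_mul_of_nonneg_left ?_ (scaled_nonneg hK hh _)
    simp only [indicator_apply, mem_Iic, mem_Ioi]
    have := neg_le_abs (Z' i - Z i)
    split_ifs <;> linarith
  rw [Finset.sum_add_distrib] at this
  linarith

end Deterministic

/-! ### Distribution functions with a density bounded below -/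

theorem C1WithDensityGE.mul_sub_le {F : ℝ → ℝ} {a b c : ℝ} (hF : C1WithDensityGE F (Icc a b) c)
    {y z : ℝ} (hy : y ∈ Icc a b) (hz : z ∈ Icc a b) (hyz : y ≤ z) :
    c * (z - y) ≤ F z - F y := by
  refine (convex_Icc a b).mul_sub_le_image_sub_of_le_deriv hF.1.continuousOn
    ((hF.1.differentiableOn one_ne_zero).mono interior_subset) (fun w hw => ?_) y hy z hz hyz
  rw [← derivWithin_of_mem_nhds (mem_interior_iff_mem_nhds.1 hw)]
  exact hF.2 w (interior_subset hw)

theorem C1WithDensityGE.strictMonoOn {F : ℝ → ℝ} {a b c : ℝ} (hc : 0 < c)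
    (hF : C1WithDensityGE F (Icc a b) c) : StrictMonoOn F (Icc a b) := by
  intro y hy z hz hyz
  have := hF.mul_sub_le hy hz hyz.le
  have := mul_pos hc (sub_pos.2 hyz)
  linarith

/-- The CDF is below `v` to the left of the generalized inverse and at least `v` to its right;
continuity carries both bounds to the point itself. -/
theorem cdf_genInv_of_continuousAt (ν : Measure ℝ) [IsProbabilityMeasure ν] {v : ℝ}
    (hv : v ∈ Ioo (0 : ℝ) 1) (hc : ContinuousAt (cdf ν) (genInv (cdf ν) v)) :
    cdf ν (genInv (cdf ν) v) = v := by
  set q := genInv (cdf ν) v with hq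
  have hne : {y | v ≤ cdf ν y}.Nonempty := by
    obtain ⟨y, hy⟩ := ((tendsto_cdf_atTop ν).eventually (lt_mem_nhds hv.2)).exists
    exact ⟨y, hy.le⟩
  have hbdd : BddBelow {y | v ≤ cdf ν y} := by
    obtain ⟨y, hy⟩ := ((tendsto_cdf_atBot ν).eventually (gt_mem_nhds hv.1)).exists
    refine ⟨y, fun z hz => ?_⟩
    by_contra! hlt
    exact absurd (monotone_cdf ν hlt.le) (not_le.2 (hy.trans_le hz))
  apply le_antisymm
  · refine le_of_tendsto (hc.tendsto.mono_left (nhdsWithin_le_nhds (s := Iio q))) ?_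
    filter_upwards [self_mem_nhdsWithin] with y hy
    exact (not_le.1 fun h => absurd (csInf_le hbdd h) (not_le.2 hy)).le
  · refine ge_of_tendsto (hc.tendsto.mono_left (nhdsWithin_le_nhds (s := Ioi q))) ?_
    filter_upwards [self_mem_nhdsWithin] with y hy
    obtain ⟨z, hz, hzy⟩ := exists_lt_of_csInf_lt hne hy
    exact le_trans hz (monotone_cdf ν hzy.le)

theorem condDF_condQuantile {p : ℕ} (κ : Kernel (Cov p) ℝ) [IsMarkovKernel κ] {x : Cov p}
    {a b c v : ℝ} (hF : C1WithDensityGE (condDF κ x) (Icc a b) c) (hv : v ∈ Ioo (0 : ℝ) 1)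
    (hq : condQuantile κ x v ∈ interior (Icc a b)) : condDF κ x (condQuantile κ x v) = v :=
  cdf_genInv_of_continuousAt (κ x) hv
    (hF.1.continuousOn.continuousAt (mem_interior_iff_mem_nhds.1 hq))

theorem condDF_eq_real {p : ℕ} (κ : Kernel (Cov p) ℝ) [IsMarkovKernel κ] (x : Cov p) (y : ℝ) :
    condDF κ x y = (κ x).real (Iic y) := cdf_eq_real _ _

/-- Joint measurability makes the wrapped response a measurable function of the pair `(X, Y)`, so
the HF sample bounds apply to it. -/
theorem measurable_condDF_uncurry {p : ℕ} (κ : Kernel (Cov p) ℝ) [IsMarkovKernel κ] :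
    Measurable fun z : Cov p × ℝ => condDF κ z.1 z.2 := by
  simp only [condDF_eq_real]
  have hs : MeasurableSet {w : (Cov p × ℝ) × ℝ | w.2 ≤ w.1.2} :=
    measurableSet_le measurable_snd (measurable_snd.comp measurable_fst)
  exact (Kernel.measurable_kernel_prodMk_left (κ := κ.comap Prod.fst measurable_fst) hs).ennreal_toReal

theorem wrappedDF_eq_real {p : ℕ} (κH κL : Kernel (Cov p) ℝ) [IsMarkovKernel κH]
    (x : Cov p) (v : ℝ) :
    wrappedDF κH κL x v = (κH x).real {y | condDF κL x y ≤ v} := by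
  have hm : Measurable fun y => condDF κL x y := (monotone_cdf (κL x)).measurable
  have : IsProbabilityMeasure ((κH x).map (fun y => condDF κL x y)) :=
    Measure.isProbabilityMeasure_map hm.aemeasurable
  rw [wrappedDF, cdf_eq_real, map_measureReal_apply hm measurableSet_Iic]
  rfl

/-- If the responses live on `[a, b]`, where `F^L(· ∣ x)` is strictly increasing, then wrapping
preserves the level of a point: `F^U(F^L(q ∣ x) ∣ x) = F^H(q ∣ x)`. -/
theorem wrappedDF_condDF {p : ℕ} (κH κL : Kernel (Cov p) ℝ) [IsMarkovKernel κH]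
    {x : Cov p} {a b q : ℝ} (hs : κH x (Icc a b)ᶜ = 0) (hm : StrictMonoOn (condDF κL x) (Icc a b))
    (hq : q ∈ Icc a b) : wrappedDF κH κL x (condDF κL x q) = condDF κH x q := by
  rw [wrappedDF_eq_real, condDF_eq_real κH x q]
  refine measureReal_congr ?_
  have : ∀ᵐ y ∂κH x, y ∈ Icc a b := hs
  filter_upwards [this] with y hy
  exact propext (hm.le_iff_le hy hq)

/-! ### An exponential tail bound for kernel-weighted sums -/

/-- Bernstein-type Chernoff bound for sums of independent bounded variables with negative mean. -/
theorem measureReal_sum_ge_le_exp {Ω : Type*} [MeasurableSpace Ω] {P : Measure Ω}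
    [IsProbabilityMeasure P] {ξ : ℕ → Ω → ℝ} (hm : ∀ i, Measurable (ξ i)) (hi : iIndepFun ξ P)
    {B m V s A : ℝ} (hB : ∀ i ω, |ξ i ω| ≤ B) (hmean : ∀ i, ∫ ω, ξ i ω ∂P ≤ -m)
    (hV : ∀ i, ∫ ω, ξ i ω ^ 2 ∂P ≤ V) (hs : 0 ≤ s) (hsB : s * B ≤ 1) (n : ℕ) :
    P.real {ω | -(n * A) ≤ ∑ i ∈ Finset.range n, ξ i ω} ≤
      Real.exp (-(n * (s * (m - A) - s ^ 2 * V))) := by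
  have hbd : ∀ i, Integrable (ξ i) P := fun i =>
    Integrable.of_bound (hm i).aestronglyMeasurable B (.of_forall fun ω => hB i ω)
  have hbd2 : ∀ i, Integrable (fun ω => ξ i ω ^ 2) P := fun i =>
    Integrable.of_bound ((hm i).pow_const 2).aestronglyMeasurable (B ^ 2) (.of_forall fun ω => by
      rw [norm_pow, Real.norm_eq_abs]; exact pow_le_pow_left₀ (abs_nonneg _) (hB i ω) 2)
  have habs : ∀ i ω, |s * ξ i ω| ≤ 1 := fun i ω => by
    rw [abs_mul, abs_of_nonneg hs]
    exact (mul_le_mul_of_nonneg_left (hB i ω) hs).trans hsB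
  have hexp : ∀ i, Integrable (fun ω => Real.exp (s * ξ i ω)) P := fun i =>
    Integrable.of_bound ((hm i).const_mul s).exp.aestronglyMeasurable (Real.exp 1)
      (.of_forall fun ω => by
        rw [Real.norm_eq_abs, Real.abs_exp]
        exact Real.exp_le_exp.2 ((le_abs_self _).trans (habs i ω)))
  have hmgf : ∀ i, mgf (ξ i) P s ≤ Real.exp (-(s * m) + s ^ 2 * V) := fun i => by
    -- Uses `exp t ≤ 1 + t + t²` for `|t| ≤ 1`, which is where `s * B ≤ 1` enters.
    calc mgf (ξ i) P s ≤ ∫ ω, (1 + s * ξ i ω + s ^ 2 * ξ i ω ^ 2) ∂P := by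
          refine integral_mono (hexp i) (((integrable_const 1).add ((hbd i).const_mul s)).add
            ((hbd2 i).const_mul _)) fun ω => ?_
          have := (abs_le.1 (Real.abs_exp_sub_one_sub_id_le (habs i ω))).2
          simp only
          rw [mul_pow] at this
          linarith
      _ = 1 + s * ∫ ω, ξ i ω ∂P + s ^ 2 * ∫ ω, ξ i ω ^ 2 ∂P := by
          have h1 : Integrable (fun ω => 1 + s * ξ i ω) P :=
            (integrable_const 1).add ((hbd i).const_mul s)
          rw [integral_add h1 ((hbd2 i).const_mul _),
            integral_add (integrable_const 1) ((hbd i).const_mul s), integral_const_mul,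
            integral_const_mul]
          simp
      _ ≤ 1 + (-(s * m) + s ^ 2 * V) := by
          have h1 := mul_le_mul_of_nonneg_left (hmean i) hs
          have h2 := mul_le_mul_of_nonneg_left (hV i) (sq_nonneg s)
          linarith
      _ ≤ _ := by rw [add_comm]; exact Real.add_one_le_exp _
  have hsum : Measurable (∑ i ∈ Finset.range n, ξ i) :=
    Finset.sum_fn (Finset.range n) ξ ▸ Finset.measurable_sum _ fun i _ => hm i
  have hint : Integrable (fun ω => Real.exp (s * (∑ i ∈ Finset.range n, ξ i) ω)) P :=
    Integrable.of_bound (hsum.const_mul s).exp.aestronglyMeasurable (Real.exp n)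
      (.of_forall fun ω => by
        rw [Real.norm_eq_abs, Real.abs_exp, Finset.sum_apply, Finset.mul_sum]
        refine Real.exp_le_exp.2 ?_
        calc ∑ i ∈ Finset.range n, s * ξ i ω ≤ ∑ i ∈ Finset.range n, (1 : ℝ) :=
              Finset.sum_le_sum fun i _ => (le_abs_self _).trans (habs i ω)
          _ = n := by simp)
  have hC := measure_ge_le_exp_mul_mgf (μ := P) (X := ∑ i ∈ Finset.range n, ξ i) (t := s)
    (-(n * A)) hs hint
  rw [hi.mgf_sum hm] at hC
  simp only [Finset.sum_apply] at hC
  refine hC.trans ?_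
  calc Real.exp (-s * -(n * A)) * ∏ i ∈ Finset.range n, mgf (ξ i) P s
      ≤ Real.exp (-s * -(n * A)) * ∏ i ∈ Finset.range n, Real.exp (-(s * m) + s ^ 2 * V) :=
        mul_le_mul_of_nonneg_left (Finset.prod_le_prod (fun i _ => mgf_nonneg) fun i _ => hmgf i)
          (Real.exp_pos _).le
    _ = _ := by
        rw [Finset.prod_const, Finset.card_range, ← Real.exp_nat_mul, ← Real.exp_add]
        congr 1; ring

/-! ### Kernel mass under the design law, and the local tail bound -/

section Design

variable {p : ℕ} {𝒳 : Set (Cov p)} {f K : Cov p → ℝ}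

theorem KernelConditions.continuous (hK : KernelConditions K) : Continuous K :=
  hK.lipschitz.choose_spec.continuous

theorem KernelConditions.measurable_scaled (hK : KernelConditions K) (h : ℝ) :
    Measurable (scaled K h) :=
  (hK.continuous.measurable.comp (measurable_const_smul _)).const_mul _

theorem KernelConditions.integrable_scaled (hK : KernelConditions K) {h : ℝ} (hh : 0 < h)
    (x : Cov p) : Integrable (fun t => scaled K h (t - x)) := by
  have h1 : Integrable K := hK.continuous.integrable_of_hasCompactSupport hK.compactSupport
  have h2 : Integrable (fun z => scaled K h z) :=
    (h1.comp_smul (inv_ne_zero hh.ne')).const_mul _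
  exact h2.comp_sub_right x

theorem KernelConditions.integral_scaled (hK : KernelConditions K) {h : ℝ} (hh : 0 < h)
    (x : Cov p) : ∫ t, scaled K h (t - x) = 1 := by
  rw [integral_sub_right_eq_self (fun t => scaled K h t) x]
  simp only [scaled]
  rw [integral_const_mul, Measure.integral_comp_inv_smul, hK.integral_one, finrank_euclideanSpace,
    Fintype.card_fin, abs_of_pos (pow_pos hh p), smul_eq_mul, mul_one,
    inv_mul_cancel₀ (pow_pos hh p).ne']

theorem integral_designLaw (h𝒳 : IsCompact 𝒳) (hf : DensityBounds 𝒳 f) (g : Cov p → ℝ) :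
    ∫ t, g t ∂designLaw 𝒳 f = ∫ t in 𝒳, f t * g t := by
  rw [designLaw, integral_withDensity_eq_integral_toReal_smul hf.1.ennreal_ofReal
    (.of_forall fun _ => ENNReal.ofReal_lt_top)]
  obtain ⟨c, hc, C, hfc⟩ := hf.2
  refine setIntegral_congr_fun h𝒳.measurableSet fun t ht => ?_
  simp only [smul_eq_mul]
  rw [ENNReal.toReal_ofReal (hc.le.trans (hfc t ht).1)]

theorem ae_mem_designLaw (h𝒳 : IsCompact 𝒳) : ∀ᵐ t ∂designLaw 𝒳 f, t ∈ 𝒳 :=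
  (withDensity_absolutelyContinuous _ _).ae_le (ae_restrict_mem h𝒳.measurableSet)

/-- The density bounds reduce both sides to Lebesgue integrals: the kernel-mass condition gives the
lower bound, `∫ K = 1` the upper one. The lower bound is what handles points near the boundary of
`𝒳`. -/
theorem exists_integral_scaled_designLaw_bounds (h𝒳 : IsCompact 𝒳) (hf : DensityBounds 𝒳 f)
    (hK : KernelConditions K) (hmass : KernelMass 𝒳 K) :
    ∃ h₀ > 0, ∃ m > 0, ∃ C > 0, ∀ h ∈ Ioo (0 : ℝ) h₀, ∀ x ∈ 𝒳,
      m ≤ ∫ t, scaled K h (t - x) ∂designLaw 𝒳 f ∧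
      ∫ t, scaled K h (t - x) ∂designLaw 𝒳 f ≤ C := by
  obtain ⟨h₀, hh₀, m, hm, hmh⟩ := hmass
  obtain ⟨-, c, hc, C, hfc⟩ := id hf
  refine ⟨h₀, hh₀, c * m, by positivity, max C 1, by positivity, fun h hh x hx => ?_⟩
  rw [integral_designLaw h𝒳 hf]
  have hI := (hK.integrable_scaled hh.1 x).integrableOn (s := 𝒳)
  have hI' : IntegrableOn (fun t => f t * scaled K h (t - x)) 𝒳 := by
    refine Integrable.mono' (hI.const_mul (max C 1)) (hf.1.mul
      ((hK.measurable_scaled h).comp (measurable_id.sub_const x))).aestronglyMeasurable ?_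
    filter_upwards [ae_restrict_mem h𝒳.measurableSet] with t ht
    rw [norm_mul, Real.norm_of_nonneg (hc.le.trans (hfc t ht).1),
      Real.norm_of_nonneg (scaled_nonneg hK.nonneg hh.1 _)]
    exact mul_le_mul_of_nonneg_right ((hfc t ht).2.trans (le_max_left _ _))
      (scaled_nonneg hK.nonneg hh.1 _)
  constructor
  · calc c * m ≤ c * ∫ t in 𝒳, scaled K h (t - x) :=
          mul_le_mul_of_nonneg_left (hmh h hh x hx) hc.le
      _ = ∫ t in 𝒳, c * scaled K h (t - x) := (integral_const_mul _ _).symm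
      _ ≤ _ := setIntegral_mono_on (hI.const_mul c) hI' h𝒳.measurableSet fun t ht =>
          mul_le_mul_of_nonneg_right (hfc t ht).1 (scaled_nonneg hK.nonneg hh.1 _)
  · calc ∫ t in 𝒳, f t * scaled K h (t - x) ≤ ∫ t in 𝒳, max C 1 * scaled K h (t - x) :=
          setIntegral_mono_on hI' (hI.const_mul _) h𝒳.measurableSet fun t ht =>
            mul_le_mul_of_nonneg_right ((hfc t ht).2.trans (le_max_left _ _))
              (scaled_nonneg hK.nonneg hh.1 _)
      _ = max C 1 * ∫ t in 𝒳, scaled K h (t - x) := integral_const_mul _ _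
      _ ≤ max C 1 * 1 := by
          refine mul_le_mul_of_nonneg_left ?_ (by positivity)
          rw [← hK.integral_scaled hh.1 x]
          exact setIntegral_le_integral (hK.integrable_scaled hh.1 x)
            (.of_forall fun t => scaled_nonneg hK.nonneg hh.1 _)
      _ = _ := mul_one _

theorem KernelConditions.exists_scaled_eq_zero (hK : KernelConditions K) :
    ∃ R > 0, ∀ h > 0, ∀ z : Cov p, R * h < ‖z‖ → scaled K h z = 0 := by
  obtain ⟨R, hR, hRK⟩ := hK.compactSupport.isBounded.exists_pos_norm_le
  refine ⟨R, hR, fun h hh z hz => ?_⟩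
  have : h⁻¹ • z ∉ tsupport K := fun hmem => by
    have h1 := hRK _ hmem
    rw [norm_smul, norm_inv, Real.norm_of_nonneg hh.le, inv_mul_le_iff₀ hh] at h1
    linarith [mul_comm R h]
  rw [scaled, image_eq_zero_of_notMem_tsupport this, mul_zero]

variable {Ω : Type*} [MeasurableSpace Ω] {P : Measure Ω} [IsProbabilityMeasure P]
  {X : ℕ → Ω → Cov p} {Y : ℕ → Ω → ℝ} {κ : Kernel (Cov p) ℝ} [IsMarkovKernel κ]

theorem designLaw_sFinite : SFinite (designLaw 𝒳 f) := by unfold designLaw; infer_instance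

theorem IsIIDSample.isProbabilityMeasure_law {μ : Measure (Cov p)} [SFinite μ]
    (hS : IsIIDSample P X Y μ κ) : IsProbabilityMeasure μ := by
  have h1 : IsProbabilityMeasure (μ ⊗ₘ κ) := by
    rw [← hS.law 0]
    exact Measure.isProbabilityMeasure_map
      ((hS.measurable_X 0).prodMk (hS.measurable_Y 0)).aemeasurable
  refine ⟨?_⟩
  rw [← Measure.compProd_apply_univ (μ := μ) (κ := κ)]
  exact h1.measure_univ

/-- Exponential tail bound for kernel-weighted sums whose local conditional means are at most
`-δ`, uniformly over the centre, the bandwidth and the summands. -/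
theorem IsIIDSample.exists_kernel_tail (hS : IsIIDSample P X Y (designLaw 𝒳 f) κ)
    (h𝒳 : IsCompact 𝒳) (hf : DensityBounds 𝒳 f) (hK : KernelConditions K)
    (hmass : KernelMass 𝒳 K) :
    ∃ R > 0, ∃ h₀ > 0, ∃ m > 0, ∃ c > 0, ∀ h ∈ Ioo (0 : ℝ) h₀, ∀ x ∈ 𝒳, ∀ δ ∈ Icc (0 : ℝ) 1,
      ∀ g : Cov p × ℝ → ℝ, Measurable g → (∀ z, |g z| ≤ 2) →
      (∀ t ∈ 𝒳, ‖t - x‖ ≤ R * h → ∫ y, g (t, y) ∂κ t ≤ -δ) → ∀ n : ℕ,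
      P.real {ω | -(n * (m * δ)) ≤
        ∑ i ∈ Finset.range n, scaled K h (X i ω - x) * g (X i ω, Y i ω)} ≤
      Real.exp (-(c * (n * h ^ p * δ ^ 2))) := by
  have := designLaw_sFinite (𝒳 := 𝒳) (f := f)
  have hprob := hS.isProbabilityMeasure_law
  obtain ⟨R, hR, hRK⟩ := hK.exists_scaled_eq_zero
  obtain ⟨h₀, hh₀, m, hm, C, hC, hb⟩ := exists_integral_scaled_designLaw_bounds h𝒳 hf hK hmass
  obtain ⟨B', hB'⟩ := hK.bounded
  set B := max B' 1 with hBdef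
  have hB : ∀ z, K z ≤ B := fun z => (hB' z).trans (le_max_left _ _)
  have hBpos : 0 < B := by positivity
  -- Half of the drift `m * δ` is kept as margin. With variance proxy `V = 4BC / h^p`, the choice `s
  -- = mδh^p / (16BC)` maximizes `s * (mδ / 2) - s² * V`, with value `m²δ²h^p / (64BC)`.
  refine ⟨R, hR, h₀, hh₀, m / 2, by positivity, m ^ 2 / (64 * B * C), by positivity,
    fun h hh x hx δ hδ g hg hg2 hmean n => ?_⟩
  have hhp : 0 < h ^ p := pow_pos hh.1 p
  obtain ⟨hb1, hb2⟩ := hb h hh x hx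
  set W : Cov p → ℝ := fun t => scaled K h (t - x) with hW
  have hWm : Measurable W := (hK.measurable_scaled h).comp (measurable_id.sub_const x)
  have hW0 : ∀ t, 0 ≤ W t := fun t => scaled_nonneg hK.nonneg hh.1 _
  have hWB : ∀ t, W t ≤ B / h ^ p := fun t => by
    rw [div_eq_inv_mul]
    exact mul_le_mul_of_nonneg_left (hB _) (by positivity)
  have hpair : ∀ i, Measurable fun ω => (X i ω, Y i ω) := fun i =>
    (hS.measurable_X i).prodMk (hS.measurable_Y i)
  set G : Cov p × ℝ → ℝ := fun z => W z.1 * g z with hG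
  have hGm : Measurable G := (hWm.comp measurable_fst).mul hg
  have hGB : ∀ z, |G z| ≤ 2 * B / h ^ p := fun z => by
    rw [hG, abs_mul, abs_of_nonneg (hW0 _)]
    calc W z.1 * |g z| ≤ B / h ^ p * 2 :=
          mul_le_mul (hWB _) (hg2 z) (abs_nonneg _) (by positivity)
      _ = _ := by ring
  have hWi : Integrable W (designLaw 𝒳 f) :=
    Integrable.of_bound hWm.aestronglyMeasurable (B / h ^ p) (.of_forall fun t => by
      rw [Real.norm_of_nonneg (hW0 t)]; exact hWB t)
  have hGi : Integrable G (designLaw 𝒳 f ⊗ₘ κ) :=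
    Integrable.of_bound hGm.aestronglyMeasurable _ (.of_forall hGB)
  have hWi' : Integrable (fun z : Cov p × ℝ => W z.1) (designLaw 𝒳 f ⊗ₘ κ) :=
    Integrable.of_bound (hWm.comp measurable_fst).aestronglyMeasurable (B / h ^ p)
      (.of_forall fun t => by rw [Real.norm_of_nonneg (hW0 _)]; exact hWB _)
  have hG2i : Integrable (fun z => G z ^ 2) (designLaw 𝒳 f ⊗ₘ κ) :=
    Integrable.of_bound (hGm.pow_const 2).aestronglyMeasurable ((2 * B / h ^ p) ^ 2)
      (.of_forall fun z => by
        rw [norm_pow, Real.norm_eq_abs]; exact pow_le_pow_left₀ (abs_nonneg _) (hGB z) 2)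
  have hlaw : ∀ i, ∀ φ : Cov p × ℝ → ℝ, Measurable φ →
      ∫ ω, φ (X i ω, Y i ω) ∂P = ∫ z, φ z ∂(designLaw 𝒳 f ⊗ₘ κ) := fun i φ hφ => by
    rw [← hS.law i, integral_map (hpair i).aemeasurable hφ.aestronglyMeasurable]
  have hGi' : Integrable (fun t => ∫ y, G (t, y) ∂κ t) (designLaw 𝒳 f) := by
    simpa using Integrable.integral_compProd (κ := Kernel.const Unit (designLaw 𝒳 f))
      (η := Kernel.prodMkLeft Unit κ) (a := ()) hGi
  have hE1 : ∫ z, G z ∂(designLaw 𝒳 f ⊗ₘ κ) ≤ -(m * δ) := by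
    rw [Measure.integral_compProd hGi]
    calc ∫ t, ∫ y, G (t, y) ∂κ t ∂designLaw 𝒳 f ≤ ∫ t, W t * -δ ∂designLaw 𝒳 f := by
          refine integral_mono_ae hGi' (hWi.mul_const _) ?_
          filter_upwards [ae_mem_designLaw h𝒳] with t ht
          simp only [hG]
          rw [integral_const_mul]
          by_cases htx : ‖t - x‖ ≤ R * h
          · exact mul_le_mul_of_nonneg_left (hmean t ht htx) (hW0 t)
          · have : W t = 0 := hRK h hh.1 _ (not_le.1 htx)
            rw [this, zero_mul, zero_mul]
      _ = (∫ t, W t ∂designLaw 𝒳 f) * -δ := integral_mul_const _ _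
      _ ≤ -(m * δ) := by
          have := mul_le_mul_of_nonneg_right hb1 hδ.1
          linarith
  have hE2 : ∫ z, G z ^ 2 ∂(designLaw 𝒳 f ⊗ₘ κ) ≤ 4 * B * C / h ^ p := by
    calc ∫ z, G z ^ 2 ∂(designLaw 𝒳 f ⊗ₘ κ)
        ≤ ∫ z, 4 * B / h ^ p * W z.1 ∂(designLaw 𝒳 f ⊗ₘ κ) := by
          refine integral_mono hG2i (hWi'.const_mul _) fun z => ?_
          simp only [hG]
          have h1 : g z ^ 2 ≤ 4 := by
            have := abs_le.1 (hg2 z)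
            nlinarith
          calc (W z.1 * g z) ^ 2 = W z.1 * W z.1 * g z ^ 2 := by ring
            _ ≤ B / h ^ p * W z.1 * 4 :=
                mul_le_mul (mul_le_mul_of_nonneg_right (hWB _) (hW0 _)) h1 (sq_nonneg _)
                  (mul_nonneg (by positivity) (hW0 _))
            _ = _ := by ring
      _ = 4 * B / h ^ p * ∫ t, W t ∂designLaw 𝒳 f := by
          rw [integral_const_mul, Measure.integral_compProd hWi']
          simp
      _ ≤ 4 * B / h ^ p * C := mul_le_mul_of_nonneg_left hb2 (by positivity)
      _ = _ := by ring
  have hmain := measureReal_sum_ge_le_exp (P := P) (ξ := fun i ω => G (X i ω, Y i ω))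
    (fun i => hGm.comp (hpair i)) (hS.indep.comp (fun _ => G) fun _ => hGm)
    (B := 2 * B / h ^ p) (m := m * δ) (V := 4 * B * C / h ^ p)
    (s := m * δ / (16 * B * C) * h ^ p) (A := m / 2 * δ)
    (fun i ω => hGB _) (fun i => (hlaw i G hGm).trans_le hE1)
    (fun i => (hlaw i _ (hGm.pow_const 2)).trans_le hE2)
    (by have := hδ.1; positivity)
    (by
      have h1 : m * δ / (16 * B * C) * h ^ p * (2 * B / h ^ p) = m * δ / (8 * C) := by
        field_simp; ring
      rw [h1, div_le_one (by positivity)]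
      -- Here `m ≤ C`, because both bound the same kernel mass.
      have : m * δ ≤ m * 1 := mul_le_mul_of_nonneg_left hδ.2 hm.le
      linarith) n
  refine hmain.trans_eq ?_
  congr 2
  field_simp
  ring

end Design

/-! ### Bandwidth arithmetic -/

/-- The bias–variance balance behind `h ≍ b^{1/(2β+p)}` and `r = b^{β/(2β+p)}`. -/
theorem exists_rate_bounds {b h : ℕ → ℝ} {β : ℝ} {p : ℕ} (hβ : 0 < β)
    (hb : Tendsto b atTop (𝓝 0)) (hb_pos : ∀ᶠ k in atTop, 0 < b k) (h_pos : ∀ k, 0 < h k)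
    (hh : h =Θ[atTop] fun k => b k ^ (1 / (2 * β + p))) :
    Tendsto h atTop (𝓝 0) ∧ Tendsto (fun k => b k ^ (β / (2 * β + p))) atTop (𝓝 0) ∧
      ∃ A > 0, ∀ᶠ k in atTop, h k ^ β ≤ A * b k ^ (β / (2 * β + p)) ∧
        b k ≤ A * (h k ^ p * (b k ^ (β / (2 * β + p))) ^ 2) := by
  have hd : 0 < 2 * β + p := by positivity
  have key : ∀ e : ℝ, 0 < e → Tendsto (fun k => b k ^ e) atTop (𝓝 0) := fun e he => by
    simpa [Real.zero_rpow he.ne'] using hb.rpow_const (p := e) (Or.inr he.le)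
  refine ⟨hh.1.trans_tendsto (key _ (by positivity)), key _ (by positivity), ?_⟩
  obtain ⟨A₁, hA₁, h1⟩ := hh.1.exists_pos
  obtain ⟨A₂, hA₂, h2⟩ := hh.2.exists_pos
  refine ⟨max (A₁ ^ β) (A₂ ^ p), by positivity, ?_⟩
  filter_upwards [h1.bound, h2.bound, hb_pos] with k hk1 hk2 hbk
  have hbe : ∀ e : ℝ, 0 < b k ^ e := fun e => Real.rpow_pos_of_pos hbk e
  rw [Real.norm_of_nonneg (h_pos k).le, Real.norm_of_nonneg (hbe _).le] at hk1 hk2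
  constructor
  · calc h k ^ β ≤ (A₁ * b k ^ (1 / (2 * β + p))) ^ β :=
          Real.rpow_le_rpow (h_pos k).le hk1 hβ.le
      _ = A₁ ^ β * b k ^ (β / (2 * β + p)) := by
          rw [Real.mul_rpow hA₁.le (hbe _).le, ← Real.rpow_mul hbk.le]
          congr 2; ring
      _ ≤ _ := mul_le_mul_of_nonneg_right (le_max_left _ _) (hbe _).le
  -- The exponents `p / (2β + p)` and `2β / (2β + p)` add up to one.
  · have h3 : (b k ^ (1 / (2 * β + p))) ^ p * (b k ^ (β / (2 * β + p))) ^ 2 = b k := by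
      rw [← Real.rpow_natCast, ← Real.rpow_natCast, ← Real.rpow_mul hbk.le, ← Real.rpow_mul hbk.le,
        ← Real.rpow_add hbk]
      convert Real.rpow_one (b k) using 2
      push_cast
      field_simp
      ring
    calc b k = (b k ^ (1 / (2 * β + p))) ^ p * (b k ^ (β / (2 * β + p))) ^ 2 := h3.symm
      _ ≤ (A₂ * h k) ^ p * (b k ^ (β / (2 * β + p))) ^ 2 :=
          mul_le_mul_of_nonneg_right (pow_le_pow_left₀ (hbe _).le hk2 p) (sq_nonneg _)
      _ = A₂ ^ p * (h k ^ p * (b k ^ (β / (2 * β + p))) ^ 2) := by ring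
      _ ≤ _ := mul_le_mul_of_nonneg_right (le_max_right _ _)
          (mul_nonneg (pow_nonneg (h_pos k).le p) (sq_nonneg _))

theorem exp_neg_inv_le {ε : ℝ} (hε : 0 < ε) : Real.exp (-ε⁻¹) ≤ ε := by
  rw [Real.exp_neg, inv_le_comm₀ (Real.exp_pos _) hε]
  linarith [Real.add_one_le_exp ε⁻¹]

/-- Smoothing bias over the kernel's support. The Hölder constant is not assumed nonnegative, hence
`max C 0`. -/
theorem HolderClass.abs_sub_le_of_norm_le {p : ℕ} {𝒳 : Set (Cov p)} {β C : ℝ} {g : Cov p → ℝ}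
    (hg : HolderClass 𝒳 β C g) (hβ : 0 < β) {t x : Cov p} (ht : t ∈ 𝒳) (hx : x ∈ 𝒳)
    {R h A r : ℝ} (hR : 0 < R) (hh : 0 < h) (htx : ‖t - x‖ ≤ R * h) (hA : h ^ β ≤ A * r) :
    |g t - g x| ≤ max C 0 * R ^ β * A * r := by
  calc |g t - g x| ≤ C * ‖t - x‖ ^ β := hg t ht x hx
    _ ≤ max C 0 * ‖t - x‖ ^ β := mul_le_mul_of_nonneg_right (le_max_left _ _) (by positivity)
    _ ≤ max C 0 * (R * h) ^ β :=
        mul_le_mul_of_nonneg_left (Real.rpow_le_rpow (norm_nonneg _) htx hβ.le) (le_max_right _ _)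
    _ = max C 0 * R ^ β * h ^ β := by rw [Real.mul_rpow hR.le hh.le]; ring
    _ ≤ max C 0 * R ^ β * (A * r) := mul_le_mul_of_nonneg_left hA (by positivity)
    _ = _ := by ring

/-! ### Integrals of half-line indicators -/

theorem measurable_indicator_Iic_comp {α : Type*} [MeasurableSpace α] {φ ψ : α → ℝ}
    (hφ : Measurable φ) (hψ : Measurable ψ) :
    Measurable fun z => (Iic (ψ z)).indicator (fun _ => (1 : ℝ)) (φ z) := by
  simp only [indicator_apply, mem_Iic]
  exact Measurable.ite (measurableSet_le hφ hψ) measurable_const measurable_const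

theorem integrable_indicator_Iic_comp {α : Type*} [MeasurableSpace α] (ν : Measure α)
    [IsFiniteMeasure ν] {φ : α → ℝ} (hφ : Measurable φ) (v : ℝ) :
    Integrable (fun y => (Iic v).indicator (fun _ => (1 : ℝ)) (φ y)) ν :=
  Integrable.of_bound (measurable_indicator_Iic_comp hφ measurable_const).aestronglyMeasurable 1
    (.of_forall fun y => by
      rw [Real.norm_of_nonneg (indicator_Iic_nonneg _ _)]; exact indicator_Iic_le_one _ _)

theorem integral_indicator_Iic_comp {α : Type*} [MeasurableSpace α] (ν : Measure α)
    {φ : α → ℝ} (hφ : Measurable φ) (v : ℝ) :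
    ∫ y, (Iic v).indicator (fun _ => (1 : ℝ)) (φ y) ∂ν = ν.real {y | φ y ≤ v} := by
  have : (fun y => (Iic v).indicator (fun _ => (1 : ℝ)) (φ y)) =
      {y | φ y ≤ v}.indicator fun _ => 1 := by
    ext y; simp [indicator_apply]
  rw [this, integral_indicator_const _ (measurableSet_le hφ measurable_const)]
  simp

theorem integral_const_sub_indicator_Iic {α : Type*} [MeasurableSpace α] (ν : Measure α)
    [IsProbabilityMeasure ν] {φ : α → ℝ} (hφ : Measurable φ) (v θ : ℝ) :
    ∫ y, (θ - (Iic v).indicator (fun _ => (1 : ℝ)) (φ y)) ∂ν = θ - ν.real {y | φ y ≤ v} := by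
  rw [integral_sub (integrable_const _) (integrable_indicator_Iic_comp ν hφ v),
    integral_indicator_Iic_comp ν hφ]
  simp

theorem integral_indicator_Iic_sub_const {α : Type*} [MeasurableSpace α] (ν : Measure α)
    [IsProbabilityMeasure ν] {φ : α → ℝ} (hφ : Measurable φ) (v θ : ℝ) :
    ∫ y, ((Iic v).indicator (fun _ => (1 : ℝ)) (φ y) - θ) ∂ν = ν.real {y | φ y ≤ v} - θ := by
  rw [integral_sub (integrable_indicator_Iic_comp ν hφ v) (integrable_const _),
    integral_indicator_Iic_comp ν hφ]
  simp

/-! ### Local empirical levels -/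

section Sample

variable {p : ℕ} {𝒳 : Set (Cov p)} {f K : Cov p → ℝ}
  {Ω : Type*} [MeasurableSpace Ω] {P : Measure Ω} [IsProbabilityMeasure P]
  {X : ℕ → Ω → Cov p} {Y : ℕ → Ω → ℝ} {κ : Kernel (Cov p) ℝ} [IsMarkovKernel κ]

/-- At distance of order `ρ` from the local `τ`-quantile `v₀` of `φ (X, Y)`, the kernel-weighted
empirical level differs from `τ` by a margin of order `ρ`, with probability close to one. -/
theorem IsIIDSample.exists_level_margin (hS : IsIIDSample P X Y (designLaw 𝒳 f) κ)
    (h𝒳 : IsCompact 𝒳) (hf : DensityBounds 𝒳 f) (hK : KernelConditions K)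
    (hmass : KernelMass 𝒳 K) {φ : Cov p × ℝ → ℝ} (hφ : Measurable φ) {x : Cov p} (hx : x ∈ 𝒳)
    {v₀ τ lo hi c C β A : ℝ} (hv₀ : v₀ ∈ Ioo lo hi) (hτ : τ ∈ Ioo (0 : ℝ) 1) (hc : 0 < c)
    (hβ : 0 < β) (hA : 0 < A)
    (hHold : ∀ v ∈ Icc lo hi, HolderClass 𝒳 β C (fun t => (κ t).real {y | φ (t, y) ≤ v}))
    (hlevel : (κ x).real {y | φ (x, y) ≤ v₀} = τ)
    (hgrow : ∀ v ∈ Icc lo hi, ∀ w ∈ Icc lo hi, v ≤ w →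
      c * (w - v) ≤ (κ x).real {y | φ (x, y) ≤ w} - (κ x).real {y | φ (x, y) ≤ v})
    {n : ℕ → ℕ} {h r ρ : ℕ → ℝ} (hn : ∀ᶠ k in atTop, 0 < n k) (h_pos : ∀ k, 0 < h k)
    (h_lim : Tendsto h atTop (𝓝 0)) (hr : ∀ k, 0 ≤ r k) (hrρ : ∀ᶠ k in atTop, r k ≤ ρ k)
    (hρ : Tendsto ρ atTop (𝓝 0))
    (hrate : ∀ᶠ k in atTop, h k ^ β ≤ A * r k ∧ (n k : ℝ)⁻¹ ≤ A * (h k ^ p * r k ^ 2))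
    {ε : ℝ} (hε : 0 < ε) :
    ∃ M > 0, ∃ D > 0, ∀ᶠ k in atTop,
      P.real {ω | -(n k * (D * ρ k)) ≤ ∑ i ∈ Finset.range (n k), scaled K (h k) (X i ω - x) *
        (τ - (Iic (v₀ + M * ρ k)).indicator (fun _ => (1 : ℝ)) (φ (X i ω, Y i ω)))} ≤ ε ∧
      P.real {ω | -(n k * (D * ρ k)) ≤ ∑ i ∈ Finset.range (n k), scaled K (h k) (X i ω - x) *
        ((Iic (v₀ - M * ρ k)).indicator (fun _ => (1 : ℝ)) (φ (X i ω, Y i ω)) - τ)} ≤ ε := by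
  obtain ⟨R, hR, h₀, hh₀, m, hm, c₀, hc₀, htail⟩ := hS.exists_kernel_tail h𝒳 hf hK hmass
  -- `C'` bounds the bias in units of `r`. `D` makes the tail exponent at drift `D * ρ` at least
  -- `ε⁻¹`, and `exp(-ε⁻¹) ≤ ε`. `M` is such that the growth `c * M * ρ` pays for the bias and
  -- leaves drift `D * ρ`.
  set C' := max C 0 * R ^ β * A with hC'
  have hC'0 : 0 ≤ C' := by positivity
  set D := √(A / (c₀ * ε)) with hD
  have hDpos : 0 < D := Real.sqrt_pos.2 (by positivity)
  have hD2 : D ^ 2 = A / (c₀ * ε) := Real.sq_sqrt (by positivity)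
  set M := (C' + D) / c with hM
  have hMpos : 0 < M := by positivity
  have hcM : c * M = C' + D := by rw [hM]; field_simp
  refine ⟨M, hMpos, m * D, by positivity, ?_⟩
  have hMρ : Tendsto (fun k => M * ρ k) atTop (𝓝 0) := by simpa using hρ.const_mul M
  have hDρ : Tendsto (fun k => D * ρ k) atTop (𝓝 0) := by simpa using hρ.const_mul D
  filter_upwards [hn, hrρ, hrate, h_lim.eventually (gt_mem_nhds hh₀),
    hDρ.eventually (gt_mem_nhds one_pos),
    hMρ.eventually (gt_mem_nhds (sub_pos.2 hv₀.1)),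
    hMρ.eventually (gt_mem_nhds (sub_pos.2 hv₀.2))] with k hnk hrk hratek hhk hDk hlo hhi
  have hnk' : (0 : ℝ) < n k := by exact_mod_cast hnk
  have hρ0 : 0 ≤ ρ k := (hr k).trans hrk
  have hMk : 0 ≤ M * ρ k := mul_nonneg hMpos.le hρ0
  have hexp : Real.exp (-(c₀ * (n k * h k ^ p * (D * ρ k) ^ 2))) ≤ ε := by
    refine le_trans (Real.exp_le_exp.2 (neg_le_neg ?_)) (exp_neg_inv_le hε)
    have h1 : 1 ≤ A * (n k * h k ^ p * ρ k ^ 2) := by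
      have h2 := mul_le_mul_of_nonneg_left hratek.2 hnk'.le
      rw [mul_inv_cancel₀ hnk'.ne'] at h2
      have h3 : r k ^ 2 ≤ ρ k ^ 2 := pow_le_pow_left₀ (hr k) hrk 2
      have h4 : A * (n k * h k ^ p * r k ^ 2) ≤ A * (n k * h k ^ p * ρ k ^ 2) := by
        have := (h_pos k).le
        gcongr
      linarith
    calc ε⁻¹ = ε⁻¹ * 1 := (mul_one _).symm
      _ ≤ ε⁻¹ * (A * (n k * h k ^ p * ρ k ^ 2)) := mul_le_mul_of_nonneg_left h1 (by positivity)
      _ = c₀ * (n k * h k ^ p * (D * ρ k) ^ 2) := by rw [mul_pow, hD2]; field_simp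
  have hv₀' : v₀ ∈ Icc lo hi := Ioo_subset_Icc_self hv₀
  have hup : v₀ + M * ρ k ∈ Icc lo hi := ⟨by linarith [hv₀.1], by linarith⟩
  have hdn : v₀ - M * ρ k ∈ Icc lo hi := ⟨by linarith, by linarith [hv₀.2]⟩
  have hslice : ∀ t, Measurable fun y => φ (t, y) := fun t => hφ.comp measurable_prodMk_left
  have hCr : C' * r k ≤ C' * ρ k := mul_le_mul_of_nonneg_left hrk hC'0
  have hcMρ : c * (M * ρ k) = C' * ρ k + D * ρ k := by rw [← mul_assoc, hcM]; ring
  have hassoc : -((n k : ℝ) * (m * D * ρ k)) = -(n k * (m * (D * ρ k))) := by ring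
  rw [hassoc]
  constructor
  · refine (htail (h k) ⟨h_pos k, hhk⟩ x hx (D * ρ k) ⟨by positivity, hDk.le⟩
      (fun z => τ - (Iic (v₀ + M * ρ k)).indicator (fun _ => (1 : ℝ)) (φ z))
      (measurable_const.sub (measurable_indicator_Iic_comp hφ measurable_const)) (fun z => ?_)
      (fun t ht htx => ?_) (n k)).trans hexp
    · have h1 := indicator_Iic_nonneg (v₀ + M * ρ k) (φ z)
      have h2 := indicator_Iic_le_one (v₀ + M * ρ k) (φ z)
      exact abs_le.2 ⟨by linarith [hτ.1], by linarith [hτ.2]⟩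
    · rw [integral_const_sub_indicator_Iic _ (hslice t)]
      have h1 := abs_le.1 ((hHold _ hup).abs_sub_le_of_norm_le hβ ht hx hR (h_pos k) htx hratek.1)
      have h2 := hgrow _ hv₀' _ hup (by linarith)
      rw [hlevel, add_sub_cancel_left] at h2
      linarith [h1.1]
  · refine (htail (h k) ⟨h_pos k, hhk⟩ x hx (D * ρ k) ⟨by positivity, hDk.le⟩
      (fun z => (Iic (v₀ - M * ρ k)).indicator (fun _ => (1 : ℝ)) (φ z) - τ)
      ((measurable_indicator_Iic_comp hφ measurable_const).sub measurable_const) (fun z => ?_)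
      (fun t ht htx => ?_) (n k)).trans hexp
    · have h1 := indicator_Iic_nonneg (v₀ - M * ρ k) (φ z)
      have h2 := indicator_Iic_le_one (v₀ - M * ρ k) (φ z)
      exact abs_le.2 ⟨by linarith [hτ.2], by linarith [hτ.1]⟩
    · rw [integral_indicator_Iic_sub_const _ (hslice t)]
      have h1 := abs_le.1 ((hHold _ hdn).abs_sub_le_of_norm_le hβ ht hx hR (h_pos k) htx hratek.1)
      have h2 := hgrow _ hdn _ hv₀' (by linarith)
      rw [hlevel, sub_sub_cancel] at h2
      linarith [h1.2]

/-- Pointwise tail bound for the Nadaraya–Watson distribution function, uniform in the point. -/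
theorem IsIIDSample.exists_nwCDF_tail (hS : IsIIDSample P X Y (designLaw 𝒳 f) κ)
    (h𝒳 : IsCompact 𝒳) (hf : DensityBounds 𝒳 f) (hK : KernelConditions K)
    (hmass : KernelMass 𝒳 K) {a b β C A : ℝ} (hβ : 0 < β) (hA : 0 < A)
    (hHold : ∀ y ∈ Icc a b, HolderClass 𝒳 β C (fun t => condDF κ t y))
    {n : ℕ → ℕ} {h s : ℕ → ℝ} (hn : ∀ᶠ k in atTop, 0 < n k) (h_pos : ∀ k, 0 < h k)
    (h_lim : Tendsto h atTop (𝓝 0)) (hs : ∀ᶠ k in atTop, 0 ≤ s k) (hs_lim : Tendsto s atTop (𝓝 0))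
    (hrate : ∀ᶠ k in atTop,
      h k ^ β ≤ A * s k ∧ Real.log (n k) / n k ≤ A * (h k ^ p * s k ^ 2)) :
    ∃ M > 0, ∀ᶠ k in atTop, ∀ x ∈ 𝒳, ∀ y ∈ Icc a b,
      P.real {ω | M * s k < |nwCDF K (h k) (n k) (fun i => X i ω) (fun i => Y i ω) x y
        - condDF κ x y|} ≤ 2 * ((n k : ℝ) ^ 2)⁻¹ := by
  obtain ⟨R, hR, h₀, hh₀, m, hm, c₀, hc₀, htail⟩ := hS.exists_kernel_tail h𝒳 hf hK hmass
  set C' := max C 0 * R ^ β * A with hC'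
  have hC'0 : 0 ≤ C' := by positivity
  -- This `D` makes the tail exponent at drift `D * s` at least `2 * log n`, so each one-sided
  -- probability is at most `n⁻²`. Testing at `F ± (C' + D) * s` leaves exactly that drift after the
  -- bias.
  set D := √(2 * A / c₀) with hD
  have hDpos : 0 < D := Real.sqrt_pos.2 (by positivity)
  have hD2 : D ^ 2 = 2 * A / c₀ := Real.sq_sqrt (by positivity)
  refine ⟨C' + D, by positivity, ?_⟩
  have hDs : Tendsto (fun k => D * s k) atTop (𝓝 0) := by simpa using hs_lim.const_mul D
  have hMs : Tendsto (fun k => (C' + D) * s k) atTop (𝓝 0) := by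
    simpa using hs_lim.const_mul (C' + D)
  filter_upwards [hn, hs, hrate, h_lim.eventually (gt_mem_nhds hh₀),
    hDs.eventually (gt_mem_nhds one_pos), hMs.eventually (gt_mem_nhds one_pos)]
    with k hnk hsk hratek hhk hDk hMk x hx y hy
  have hnk' : (0 : ℝ) < n k := by exact_mod_cast hnk
  have hMk0 : 0 ≤ (C' + D) * s k := mul_nonneg (by positivity) hsk
  have hDk0 : 0 ≤ D * s k := mul_nonneg hDpos.le hsk
  have hexp : Real.exp (-(c₀ * (n k * h k ^ p * (D * s k) ^ 2))) ≤ ((n k : ℝ) ^ 2)⁻¹ := by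
    rw [← Real.exp_log (inv_pos.2 (pow_pos hnk' 2)), Real.log_inv, Real.log_pow]
    refine Real.exp_le_exp.2 (neg_le_neg ?_)
    have h1 := hratek.2
    rw [div_le_iff₀ hnk'] at h1
    calc ((2 : ℕ) : ℝ) * Real.log (n k) ≤ 2 * (A * (h k ^ p * s k ^ 2) * n k) := by
          push_cast; linarith
      _ = _ := by rw [mul_pow, hD2]; field_simp
  have hF0 : 0 ≤ condDF κ x y := cdf_nonneg _ _
  have hF1 : condDF κ x y ≤ 1 := cdf_le_one _ _
  have hbias : ∀ t ∈ 𝒳, ‖t - x‖ ≤ R * h k → |(κ t).real {z | z ≤ y} - condDF κ x y| ≤ C' * s k :=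
    fun t ht htx => by
      have := (hHold y hy).abs_sub_le_of_norm_le hβ ht hx hR (h_pos k) htx hratek.1
      rwa [condDF_eq_real κ t y] at this
  have hup := (htail (h k) ⟨h_pos k, hhk⟩ x hx (D * s k) ⟨hDk0, hDk.le⟩
      (fun z => (condDF κ x y - (C' + D) * s k) - (Iic y).indicator (fun _ => (1 : ℝ)) z.2)
      (measurable_const.sub (measurable_indicator_Iic_comp measurable_snd measurable_const))
      (fun z => by
        have h1 := indicator_Iic_nonneg y z.2
        have h2 := indicator_Iic_le_one y z.2
        exact abs_le.2 ⟨by linarith, by linarith⟩)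
      (fun t ht htx => by
        simp only
        rw [integral_const_sub_indicator_Iic (κ t) measurable_id']
        have h1 := abs_le.1 (hbias t ht htx)
        linarith [h1.1]) (n k)).trans hexp
  have hdn := (htail (h k) ⟨h_pos k, hhk⟩ x hx (D * s k) ⟨hDk0, hDk.le⟩
      (fun z => (Iic y).indicator (fun _ => (1 : ℝ)) z.2 - (condDF κ x y + (C' + D) * s k))
      ((measurable_indicator_Iic_comp measurable_snd measurable_const).sub measurable_const)
      (fun z => by
        have h1 := indicator_Iic_nonneg y z.2
        have h2 := indicator_Iic_le_one y z.2
        exact abs_le.2 ⟨by linarith, by linarith⟩)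
      (fun t ht htx => by
        simp only
        rw [integral_indicator_Iic_sub_const (κ t) measurable_id']
        have h1 := abs_le.1 (hbias t ht htx)
        linarith [h1.2]) (n k)).trans hexp
  rw [two_mul]
  refine le_trans ?_ (add_le_add hup hdn)
  refine le_trans (measureReal_mono ?_ (by finiteness)) (measureReal_union_le _ _)
  intro ω hω
  by_contra hcon
  simp only [mem_union, mem_ofPred_eq, not_or, not_le] at hcon hω
  have hneg : -((n k : ℝ) * (m * (D * s k))) ≤ 0 := by
    rw [neg_nonpos]; positivity
  have h1 := lt_nwCDF_of_sum_neg (n := n k) (X := fun i => X i ω) (Z := fun i => Y i ω) (x := x)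
    hK.nonneg (h_pos k) (hcon.1.trans_le hneg)
  have h2 := nwCDF_lt_of_sum_neg (n := n k) (X := fun i => X i ω) (Z := fun i => Y i ω) (x := x)
    hK.nonneg (h_pos k) (hcon.2.trans_le hneg)
  exact absurd hω (not_lt.2 (abs_le.2 ⟨by linarith, by linarith⟩))

/-- The kernel weight carried by sample points where an independent event of small probability
occurs is small. -/
theorem IsIIDSample.exists_bad_weight_le (hS : IsIIDSample P X Y (designLaw 𝒳 f) κ)
    (h𝒳 : IsCompact 𝒳) (hf : DensityBounds 𝒳 f) (hK : KernelConditions K)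
    (hmass : KernelMass 𝒳 K) {a b : ℝ} (hsupp : ∀ t ∈ 𝒳, κ t (Icc a b)ᶜ = 0)
    {E : Type*} [MeasurableSpace E] {L : Ω → E} (hL : Measurable L)
    (hXL : ∀ i, IndepFun (fun ω => (X i ω, Y i ω)) L P) :
    ∃ h₀ > 0, ∃ C > 0, ∀ h ∈ Ioo (0 : ℝ) h₀, ∀ x ∈ 𝒳, ∀ S : Set ((Cov p × ℝ) × E),
      MeasurableSet S → ∀ η : ℝ,
      (∀ t ∈ 𝒳, ∀ y ∈ Icc a b, P.real {ω | ((t, y), L ω) ∈ S} ≤ η) → ∀ (n : ℕ) (T : ℝ),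
      T * P.real {ω | T ≤ ∑ i ∈ Finset.range n, scaled K h (X i ω - x) *
        S.indicator (fun _ => (1 : ℝ)) ((X i ω, Y i ω), L ω)} ≤ n * (C * η) := by
  have := designLaw_sFinite (𝒳 := 𝒳) (f := f)
  have hprob := hS.isProbabilityMeasure_law
  have hprobL : IsProbabilityMeasure (P.map L) := Measure.isProbabilityMeasure_map hL.aemeasurable
  obtain ⟨h₀, hh₀, m, hm, C, hC, hb⟩ := exists_integral_scaled_designLaw_bounds h𝒳 hf hK hmass
  obtain ⟨B, hB⟩ := hK.bounded
  refine ⟨h₀, hh₀, C, hC, fun h hh x hx S hSm η hη n T => ?_⟩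
  have hhp : 0 < h ^ p := pow_pos hh.1 p
  set W : Cov p → ℝ := fun t => scaled K h (t - x) with hW
  have hWm : Measurable W := (hK.measurable_scaled h).comp (measurable_id.sub_const x)
  have hW0 : ∀ t, 0 ≤ W t := fun t => scaled_nonneg hK.nonneg hh.1 _
  have hWB : ∀ t, W t ≤ (h ^ p)⁻¹ * B := fun t => mul_le_mul_of_nonneg_left (hB _) (by positivity)
  have hpair : ∀ i, Measurable fun ω => (X i ω, Y i ω) := fun i =>
    (hS.measurable_X i).prodMk (hS.measurable_Y i)
  have hWi' : Integrable (fun z : Cov p × ℝ => W z.1) (designLaw 𝒳 f ⊗ₘ κ) :=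
    Integrable.of_bound (hWm.comp measurable_fst).aestronglyMeasurable _
      (.of_forall fun t => by rw [Real.norm_of_nonneg (hW0 _)]; exact hWB _)
  set Φ : (Cov p × ℝ) × E → ℝ := fun z => W z.1.1 * S.indicator (fun _ => (1 : ℝ)) z with hΦ
  have hΦm : Measurable Φ := (hWm.comp (measurable_fst.comp measurable_fst)).mul
    (measurable_const.indicator hSm)
  have hI0 : ∀ z, 0 ≤ S.indicator (fun _ => (1 : ℝ)) z := fun z =>
    indicator_nonneg (fun _ _ => zero_le_one) z
  have hΦ0 : ∀ z, 0 ≤ Φ z := fun z => mul_nonneg (hW0 _) (hI0 z)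
  have hΦB : ∀ z, ‖Φ z‖ ≤ (h ^ p)⁻¹ * B := fun z => by
    rw [Real.norm_of_nonneg (hΦ0 z)]
    exact (mul_le_of_le_one_right (hW0 _) (indicator_le_self' (fun _ _ => zero_le_one) z)).trans
      (hWB _)
  have hmeas : ∀ i, Measurable fun ω => Φ ((X i ω, Y i ω), L ω) := fun i =>
    hΦm.comp ((hpair i).prodMk hL)
  have hΦi : ∀ i, Integrable (fun ω => Φ ((X i ω, Y i ω), L ω)) P := fun i =>
    Integrable.of_bound (hmeas i).aestronglyMeasurable _ (.of_forall fun ω => hΦB _)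
  have hsuppae : ∀ᵐ z ∂(designLaw 𝒳 f ⊗ₘ κ), z.1 ∈ 𝒳 ∧ z.2 ∈ Icc a b := by
    refine Measure.ae_compProd_of_ae_ae ((h𝒳.measurableSet.preimage measurable_fst).inter
      (measurableSet_Icc.preimage measurable_snd)) ?_
    filter_upwards [ae_mem_designLaw h𝒳] with t ht
    have : ∀ᵐ y ∂κ t, y ∈ Icc a b := hsupp t ht
    filter_upwards [this] with y hy using ⟨ht, hy⟩
  have hE : ∀ i, ∫ ω, Φ ((X i ω, Y i ω), L ω) ∂P ≤ C * η := fun i => by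
    -- Independence makes the joint law a product, so the event can be integrated over `L` with the
    -- pair frozen at `(t, y)`, where its probability is at most `η`.
    have hmap : P.map (fun ω => ((X i ω, Y i ω), L ω)) = (designLaw 𝒳 f ⊗ₘ κ).prod (P.map L) := by
      rw [(indepFun_iff_map_prod_eq_prod_map_map (hpair i).aemeasurable hL.aemeasurable).1 (hXL i),
        hS.law i]
    have hΦi' : Integrable Φ ((designLaw 𝒳 f ⊗ₘ κ).prod (P.map L)) :=
      Integrable.of_bound hΦm.aestronglyMeasurable _ (.of_forall hΦB)
    -- Nonnegativity of `η` is not assumed; it follows by evaluating the hypothesis at one point of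
    -- the support.
    have hη0 : 0 ≤ η := by
      obtain ⟨z, hz⟩ := hsuppae.exists
      exact measureReal_nonneg.trans (hη z.1 hz.1 z.2 hz.2)
    rw [← integral_map (φ := fun ω => ((X i ω, Y i ω), L ω)) ((hpair i).prodMk hL).aemeasurable
      hΦm.aestronglyMeasurable, hmap, integral_prod _ hΦi']
    calc ∫ z, ∫ l, Φ (z, l) ∂P.map L ∂(designLaw 𝒳 f ⊗ₘ κ)
        ≤ ∫ z, W z.1 * η ∂(designLaw 𝒳 f ⊗ₘ κ) := by
          refine integral_mono_ae hΦi'.integral_prod_left (hWi'.mul_const η) ?_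
          filter_upwards [hsuppae] with z hz
          simp only [hΦ]
          rw [integral_const_mul]
          refine mul_le_mul_of_nonneg_left ?_ (hW0 _)
          have hsm : MeasurableSet (Prod.mk z ⁻¹' S) := measurable_prodMk_left hSm
          calc ∫ l, S.indicator (fun _ => (1 : ℝ)) (z, l) ∂P.map L
              = ∫ l, (Prod.mk z ⁻¹' S).indicator (fun _ => (1 : ℝ)) l ∂P.map L := rfl
            _ = (P.map L).real (Prod.mk z ⁻¹' S) := by
                rw [integral_indicator_const _ hsm]; simp
            _ = P.real {ω | (z, L ω) ∈ S} := by
                rw [map_measureReal_apply hL hsm]; rfl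
            _ ≤ η := hη z.1 hz.1 z.2 hz.2
      _ = (∫ t, W t ∂designLaw 𝒳 f) * η := by
          rw [integral_mul_const, Measure.integral_compProd hWi']
          simp
      _ ≤ C * η := mul_le_mul_of_nonneg_right (hb h hh x hx).2 hη0
  -- Markov's inequality for the total bad weight.
  refine (mul_meas_ge_le_integral_of_nonneg (.of_forall fun ω =>
    Finset.sum_nonneg fun i _ => hΦ0 ((X i ω, Y i ω), L ω))
    (integrable_finsetSum _ fun i _ => hΦi i) T).trans ?_
  rw [integral_finsetSum _ fun i _ => hΦi i]
  refine (Finset.sum_le_sum fun i _ => hE i).trans_eq ?_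
  simp

end Sample

/-! ### Rates of the two estimators -/

section Rates

theorem exists_polynomial_rate_bounds {n : ℕ → ℕ} {h : ℕ → ℝ} {β : ℝ} {p : ℕ} (hβ : 0 < β)
    (hn : Tendsto n atTop atTop) (h_pos : ∀ k, 0 < h k)
    (hh : h =Θ[atTop] fun k => (n k : ℝ) ^ (-(1 / (2 * β + p)))) :
    Tendsto h atTop (𝓝 0) ∧ Tendsto (fun k => (n k : ℝ) ^ (-(β / (2 * β + p)))) atTop (𝓝 0) ∧
      ∃ A > 0, ∀ᶠ k in atTop, h k ^ β ≤ A * (n k : ℝ) ^ (-(β / (2 * β + p))) ∧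
        (n k : ℝ)⁻¹ ≤ A * (h k ^ p * ((n k : ℝ) ^ (-(β / (2 * β + p)))) ^ 2) := by
  -- Rewrites every power of `n` as a power of `n⁻¹`, so that the general balance applies with `b =
  -- n⁻¹`.
  simp only [← Real.inv_rpow (Nat.cast_nonneg _), Real.rpow_neg (Nat.cast_nonneg _)] at hh ⊢
  refine exists_rate_bounds hβ (tendsto_inv_atTop_zero.comp
    (tendsto_natCast_atTop_atTop.comp hn)) ?_ h_pos hh
  filter_upwards [hn.eventually_gt_atTop 0] with k hk
  exact inv_pos.2 (Nat.cast_pos.2 hk)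

theorem exists_logarithmic_rate_bounds {n : ℕ → ℕ} {h : ℕ → ℝ} {β : ℝ} {p : ℕ} (hβ : 0 < β)
    (hn : Tendsto n atTop atTop) (h_pos : ∀ k, 0 < h k)
    (hh : h =Θ[atTop] fun k => (Real.log (n k) / n k) ^ (1 / (2 * β + p))) :
    Tendsto h atTop (𝓝 0) ∧
      Tendsto (fun k => (Real.log (n k) / n k) ^ (β / (2 * β + p))) atTop (𝓝 0) ∧
      ∃ A > 0, ∀ᶠ k in atTop, h k ^ β ≤ A * (Real.log (n k) / n k) ^ (β / (2 * β + p)) ∧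
        Real.log (n k) / n k ≤
          A * (h k ^ p * ((Real.log (n k) / n k) ^ (β / (2 * β + p))) ^ 2) := by
  refine exists_rate_bounds hβ (Real.isLittleO_log_id_atTop.tendsto_div_nhds_zero.comp
    (tendsto_natCast_atTop_atTop.comp hn)) ?_ h_pos hh
  filter_upwards [hn.eventually_gt_atTop 1] with k hk
  exact div_pos (Real.log_pos (Nat.one_lt_cast.2 hk)) (Nat.cast_pos.2 (by omega))

/-- The exponent is at most one and `log n ≥ 1` eventually. This comparison makes the `nL⁻²` failure
probability negligible against the rate. -/
theorem eventually_inv_le_logarithmic_rate {n : ℕ → ℕ} {β : ℝ} {p : ℕ} (hβ : 0 < β)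
    (hn : Tendsto n atTop atTop) :
    ∀ᶠ k in atTop, (n k : ℝ)⁻¹ ≤ (Real.log (n k) / n k) ^ (β / (2 * β + p)) := by
  filter_upwards [hn.eventually_gt_atTop 0,
    ((Real.tendsto_log_atTop.comp tendsto_natCast_atTop_atTop).comp hn).eventually_ge_atTop 1]
    with k hk hlog
  have hk' : (0 : ℝ) < n k := Nat.cast_pos.2 hk
  have hk1 : (1 : ℝ) ≤ n k := Nat.one_le_cast.2 hk
  have he : β / (2 * β + p) ≤ 1 := by
    rw [div_le_one (by positivity)]
    linarith [Nat.cast_nonneg (α := ℝ) p]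
  calc (n k : ℝ)⁻¹ = (n k : ℝ)⁻¹ ^ (1 : ℝ) := (Real.rpow_one _).symm
    _ ≤ (n k : ℝ)⁻¹ ^ (β / (2 * β + p)) :=
        Real.rpow_le_rpow_of_exponent_ge (inv_pos.2 hk') (inv_le_one_of_one_le₀ hk1) he
    _ ≤ _ := by
        refine Real.rpow_le_rpow (inv_pos.2 hk').le ?_ (by positivity)
        rw [inv_eq_one_div]
        exact div_le_div_of_nonneg_right hlog hk'.le

variable {Ω : Type*} [MeasurableSpace Ω] {P : Measure Ω} [IsProbabilityMeasure P]
  {p : ℕ} {𝒳 : Set (Cov p)} {τ : ℝ} {κH κL : Kernel (Cov p) ℝ} [IsMarkovKernel κH]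
  {u : Cov p → ℝ} {a b ul ur βq βu βL : ℝ} {fH fL K : Cov p → ℝ}
  {XH XL : ℕ → Ω → Cov p} {YH YL : ℕ → Ω → ℝ}

theorem kernelQuantile_isBigOp (hτ : τ ∈ Ioo (0 : ℝ) 1)
    (hreg : Regularity 𝒳 τ κH κL u a b ul ur) (hβq : 0 < βq)
    (hsmooth : Smoothness 𝒳 τ κH κL u a b ul ur βq βu βL)
    (hfH : DensityBounds 𝒳 fH) (hK : KernelConditions K) (hmass : KernelMass 𝒳 K)
    (hH : IsIIDSample P XH YH (designLaw 𝒳 fH) κH)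
    {nH : ℕ → ℕ} (hnH : Tendsto nH atTop atTop) {hq : ℕ → ℝ} (hq_pos : ∀ k, 0 < hq k)
    (hq_rate : hq =Θ[atTop] fun k => (nH k : ℝ) ^ (-(1 / (2 * βq + p))))
    {x : Cov p} (hx : x ∈ 𝒳) :
    IsBigOp P
      (fun k ω => kernelQuantile K (hq k) (nH k) (fun i => XH i ω) (fun i => YH i ω) τ x
        - condQuantile κH x τ)
      (fun k => (nH k : ℝ) ^ (-(βq / (2 * βq + p)))) := by
  intro ε hε
  obtain ⟨h_lim, r_lim, A, hA, hrate⟩ := exists_polynomial_rate_bounds hβq hnH hq_pos hq_rate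
  obtain ⟨c, hc, hdens⟩ := hreg.density_H
  obtain ⟨C, hHold⟩ := hsmooth.cdf_H
  have hqmem := hreg.quantile_mem x hx
  obtain ⟨M, hM, D, hD, hev⟩ := hH.exists_level_margin hreg.compact hfH hK hmass
    (φ := Prod.snd) measurable_snd hx (v₀ := condQuantile κH x τ) (lo := a) (hi := b) (c := c)
    (C := C) (by rwa [interior_Icc] at hqmem) hτ hc hβq hA
    (fun v hv => by simpa only [condDF_eq_real, Iic_def] using hHold v hv)
    (by simpa only [condDF_eq_real, Iic_def] using condDF_condQuantile κH (hdens x hx) hτ hqmem)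
    (fun v hv w hw hvw => by
      simpa only [condDF_eq_real, Iic_def] using (hdens x hx).mul_sub_le hv hw hvw)
    (hnH.eventually_gt_atTop 0) hq_pos h_lim (fun k => by positivity) (.of_forall fun k => le_rfl)
    r_lim hrate (half_pos hε)
  refine ⟨M, hM, ?_⟩
  filter_upwards [hev] with k hk
  rw [← add_halves ε]
  refine le_trans ?_ (add_le_add hk.1 hk.2)
  refine le_trans (measureReal_mono ?_ (by finiteness)) (measureReal_union_le _ _)
  intro ω hω
  by_contra hcon
  simp only [mem_union, mem_ofPred_eq, not_or, not_le] at hcon hω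
  have hneg : -((nH k : ℝ) * (D * (nH k : ℝ) ^ (-(βq / (2 * βq + p))))) ≤ 0 := by
    rw [neg_nonpos]; positivity
  have h1 := lt_nwCDF_of_sum_neg (n := nH k) (X := fun i => XH i ω) (Z := fun i => YH i ω) (x := x)
    hK.nonneg (hq_pos k) (hcon.1.trans_le hneg)
  have h2 := nwCDF_lt_of_sum_neg (n := nH k) (X := fun i => XH i ω) (Z := fun i => YH i ω) (x := x)
    hK.nonneg (hq_pos k) (hcon.2.trans_le hneg)
  have h3 := genInv_nwCDF_mem_Icc hK.nonneg (hq_pos k) hτ.1 h2 h1.le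
  exact absurd hω (not_lt.2 (abs_le.2
    ⟨by unfold kernelQuantile; linarith [h3.1], by unfold kernelQuantile; linarith [h3.2]⟩))

/-- Measurability jointly in the evaluation point and the sample is needed to apply Fubini to the
estimation error at a random HF point. -/
theorem measurable_nwCDF_uncurry (hK : KernelConditions K) (h : ℝ) (n : ℕ) :
    Measurable fun w : (Cov p × ℝ) × (ℕ → Cov p × ℝ) =>
      nwCDF K h n (fun j => (w.2 j).1) (fun j => (w.2 j).2) w.1.1 w.1.2 := by
  have hX : ∀ j, Measurable fun w : (Cov p × ℝ) × (ℕ → Cov p × ℝ) => (w.2 j).1 := fun j =>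
    measurable_fst.comp ((measurable_pi_apply j).comp measurable_snd)
  have hY : ∀ j, Measurable fun w : (Cov p × ℝ) × (ℕ → Cov p × ℝ) => (w.2 j).2 := fun j =>
    measurable_snd.comp ((measurable_pi_apply j).comp measurable_snd)
  have hW : ∀ j, Measurable fun w : (Cov p × ℝ) × (ℕ → Cov p × ℝ) =>
      scaled K h ((w.2 j).1 - w.1.1) := fun j =>
    (hK.measurable_scaled h).comp ((hX j).sub (measurable_fst.comp measurable_fst))
  unfold nwCDF
  exact Finset.measurable_sum _ fun j _ => ((hW j).div (Finset.measurable_sum _ fun l _ => hW l)).mul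
    (measurable_indicator_Iic_comp (hY j) (measurable_snd.comp measurable_fst))

/-- The wrapped HF responses are estimated with error at most `M * s k`, except at sample points
whose total kernel weight is of smaller order than `nH k * ρ k`. -/
theorem exists_wrapped_error_weight_le [IsMarkovKernel κL]
    (hreg : Regularity 𝒳 τ κH κL u a b ul ur)
    (hfH : DensityBounds 𝒳 fH) (hK : KernelConditions K) (hmass : KernelMass 𝒳 K)
    (hH : IsIIDSample P XH YH (designLaw 𝒳 fH) κH)
    (hL : IsIIDSample P XL YL (designLaw 𝒳 fL) κL)
    (hHL : IndepFun (fun ω i => (XH i ω, YH i ω)) (fun ω j => (XL j ω, YL j ω)) P)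
    {nH nL : ℕ → ℕ} (hnH : Tendsto nH atTop atTop) (hnL : Tendsto nL atTop atTop)
    {hu hl s ρ : ℕ → ℝ} (hu_pos : ∀ k, 0 < hu k) (hu_lim : Tendsto hu atTop (𝓝 0)) {M : ℝ}
    (htail : ∀ᶠ k in atTop, ∀ x ∈ 𝒳, ∀ y ∈ Icc a b,
      P.real {ω | M * s k < |nwCDF K (hl k) (nL k) (fun i => XL i ω) (fun i => YL i ω) x y
        - condDF κL x y|} ≤ 2 * ((nL k : ℝ) ^ 2)⁻¹)
    (hρ : ∀ᶠ k in atTop, (nL k : ℝ)⁻¹ ≤ ρ k) {x : Cov p} (hx : x ∈ 𝒳) {D ε : ℝ} (hD : 0 < D)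
    (hε : 0 < ε) :
    ∀ᶠ k in atTop, P.real {ω | nH k * (D * ρ k) ≤
      ∑ i ∈ Finset.range (nH k), scaled K (hu k) (XH i ω - x) *
        (Ioi (M * s k)).indicator (fun _ => (1 : ℝ))
          |nwCDF K (hl k) (nL k) (fun j => XL j ω) (fun j => YL j ω) (XH i ω) (YH i ω)
            - condDF κL (XH i ω) (YH i ω)|} ≤ ε := by
  have hLm : Measurable fun ω j => (XL j ω, YL j ω) :=
    measurable_pi_lambda _ fun j => (hL.measurable_X j).prodMk (hL.measurable_Y j)
  obtain ⟨h₀, hh₀, C, hC, hbad⟩ := hH.exists_bad_weight_le hreg.compact hfH hK hmass hreg.supp_H hLm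
    fun i => hHL.comp (measurable_pi_apply i) measurable_id
  -- Ratio of the Markov bound `nH * C * 2 * nL⁻²` to the threshold `nH * D * nL⁻¹`, which is at
  -- most `nH * D * ρ`.
  have hlim : Tendsto (fun k => 2 * C / D * (nL k : ℝ)⁻¹) atTop (𝓝 0) := by
    simpa using (tendsto_inv_atTop_zero.comp
      (tendsto_natCast_atTop_atTop.comp hnL)).const_mul (2 * C / D)
  filter_upwards [htail, hρ, hu_lim.eventually (gt_mem_nhds hh₀), hnH.eventually_gt_atTop 0,
    hnL.eventually_gt_atTop 0, hlim.eventually (gt_mem_nhds hε)] with k htk hρk hhk hnHk hnLk hεk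
  have hnH' : (0 : ℝ) < nH k := Nat.cast_pos.2 hnHk
  have hnL' : (0 : ℝ) < nL k := Nat.cast_pos.2 hnLk
  have hρ0 : 0 < ρ k := (inv_pos.2 hnL').trans_le hρk
  have hmeas : MeasurableSet {w : (Cov p × ℝ) × (ℕ → Cov p × ℝ) | M * s k <
      |nwCDF K (hl k) (nL k) (fun j => (w.2 j).1) (fun j => (w.2 j).2) w.1.1 w.1.2
        - condDF κL w.1.1 w.1.2|} :=
    measurableSet_lt measurable_const (((measurable_nwCDF_uncurry hK _ _).sub
      ((measurable_condDF_uncurry κL).comp measurable_fst)).abs)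
  have hB := hbad (hu k) ⟨hu_pos k, hhk⟩ x hx _ hmeas (2 * ((nL k : ℝ) ^ 2)⁻¹)
    (fun t ht y hy => htk t ht y hy) (nH k) (nH k * (D * ρ k))
  have hB' := (le_div_iff₀' (by positivity)).2 hB
  refine hB'.trans (le_trans ?_ hεk.le)
  rw [div_le_iff₀ (by positivity)]
  calc (nH k : ℝ) * (C * (2 * ((nL k : ℝ) ^ 2)⁻¹))
      = 2 * C / D * (nL k : ℝ)⁻¹ * (nH k * (D * (nL k : ℝ)⁻¹)) := by field_simp
    _ ≤ _ := by gcongr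

theorem wrapperEstimator_isBigOp [IsMarkovKernel κL] (hτ : τ ∈ Ioo (0 : ℝ) 1)
    (hlink : LocalQuantileLink 𝒳 τ κH κL u)
    (hreg : Regularity 𝒳 τ κH κL u a b ul ur) (hβu : 0 < βu) (hβL : 0 < βL)
    (hsmooth : Smoothness 𝒳 τ κH κL u a b ul ur βq βu βL)
    (hfH : DensityBounds 𝒳 fH) (hfL : DensityBounds 𝒳 fL)
    (hK : KernelConditions K) (hmass : KernelMass 𝒳 K)
    (hH : IsIIDSample P XH YH (designLaw 𝒳 fH) κH)
    (hL : IsIIDSample P XL YL (designLaw 𝒳 fL) κL)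
    (hHL : IndepFun (fun ω i => (XH i ω, YH i ω)) (fun ω j => (XL j ω, YL j ω)) P)
    {nH nL : ℕ → ℕ} (hnH : Tendsto nH atTop atTop) (hnL : Tendsto nL atTop atTop)
    {hu hl : ℕ → ℝ} (hu_pos : ∀ k, 0 < hu k) (hl_pos : ∀ k, 0 < hl k)
    (hu_rate : hu =Θ[atTop] fun k => (nH k : ℝ) ^ (-(1 / (2 * βu + p))))
    (hl_rate : hl =Θ[atTop] fun k => (Real.log (nL k) / nL k) ^ (1 / (2 * βL + p)))
    {x : Cov p} (hx : x ∈ 𝒳) :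
    IsBigOp P
      (fun k ω => wrapperEstimator K (hu k) (hl k) (nH k) (nL k)
          (fun i => XH i ω) (fun i => YH i ω) (fun j => XL j ω) (fun j => YL j ω) τ x
        - condQuantile κH x τ)
      (fun k => (nH k : ℝ) ^ (-(βu / (2 * βu + p)))
        + (Real.log (nL k) / nL k) ^ (βL / (2 * βL + p))) := by
  intro ε hε
  -- Five exceptional events: the level test on either side, the bad weight, and the LF estimator at
  -- `q + M * ρ` and at `q - M * ρ`.
  have hε5 : 0 < ε / 5 := by positivity
  obtain ⟨hu_lim, r_lim, A, hA, hrate⟩ := exists_polynomial_rate_bounds hβu hnH hu_pos hu_rate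
  obtain ⟨hl_lim, s_lim, A', hA', hrate'⟩ := exists_logarithmic_rate_bounds hβL hnL hl_pos hl_rate
  have hs_inv := eventually_inv_le_logarithmic_rate (p := p) hβL hnL
  set r : ℕ → ℝ := fun k => (nH k : ℝ) ^ (-(βu / (2 * βu + p)))
  set s : ℕ → ℝ := fun k => (Real.log (nL k) / nL k) ^ (βL / (2 * βL + p))
  set ρ : ℕ → ℝ := fun k => r k + s k with hρdef
  have hr0 : ∀ k, 0 ≤ r k := fun k => by positivity
  have hs0 : ∀ᶠ k in atTop, 0 ≤ s k := by
    filter_upwards [hs_inv] with k hk using le_trans (by positivity) hk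
  have hρ_lim : Tendsto ρ atTop (𝓝 0) := by simpa using r_lim.add s_lim
  obtain ⟨cH, hcH, hdensH⟩ := hreg.density_H
  obtain ⟨cL, hcL, hdensL⟩ := hreg.density_L
  obtain ⟨cU, hcU, hdensU⟩ := hsmooth.density_U
  obtain ⟨CL, hHoldL⟩ := hsmooth.cdf_L
  obtain ⟨CU, hHoldU⟩ := hsmooth.cdf_U
  set q := condQuantile κH x τ with hqdef
  have hqmem : q ∈ interior (Icc a b) := hreg.quantile_mem x hx
  have hqIcc : q ∈ Icc a b := interior_subset hqmem
  have hqIoo : q ∈ Ioo a b := by rwa [interior_Icc] at hqmem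
  have humem := hreg.level_mem x hx
  rw [interior_Icc] at humem
  have hFH : condDF κH x q = τ := condDF_condQuantile κH (hdensH x hx) hτ hqmem
  have hFL : condDF κL x q = u x := by
    have hl := hlink x hx
    have := condDF_condQuantile κL (hdensL x hx) hl.1 (by rw [← hl.2]; exact hqmem)
    rwa [← hl.2] at this
  have hFU : wrappedDF κH κL x (u x) = τ := by
    rw [← hFL, wrappedDF_condDF κH κL (hreg.supp_H x hx) ((hdensL x hx).strictMonoOn hcL) hqIcc, hFH]
  obtain ⟨M₁, hM₁, htail⟩ := hL.exists_nwCDF_tail hreg.compact hfL hK hmass hβL hA' hHoldL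
    (hnL.eventually_gt_atTop 0) hl_pos hl_lim hs0 s_lim hrate'
  -- The margin is taken at the combined rate `ρ = r + s` rather than `r`, so that it can absorb the
  -- bad weight.
  obtain ⟨M₂, hM₂, D, hD, hlevel⟩ := hH.exists_level_margin hreg.compact hfH hK hmass
    (measurable_condDF_uncurry κL) hx (v₀ := u x) (ρ := ρ) humem hτ hcU hβu hA
    (fun v hv => by simpa only [wrappedDF_eq_real] using hHoldU v hv)
    (by simpa only [wrappedDF_eq_real] using hFU)
    (fun v hv w hw hvw => by
      simpa only [wrappedDF_eq_real] using (hdensU x hx).mul_sub_le hv hw hvw)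
    (hnH.eventually_gt_atTop 0) hu_pos hu_lim hr0
    (by filter_upwards [hs0] with k hk using le_add_of_nonneg_right hk) hρ_lim hrate hε5
  have hbad := exists_wrapped_error_weight_le (ρ := ρ) hreg hfH hK hmass hH hL hHL hnH hnL hu_pos
    hu_lim htail (by filter_upwards [hs_inv] with k hk using hk.trans (le_add_of_nonneg_left (hr0 k)))
    hx hD hε5
  -- The estimated level is within `(M₁ + M₂) * ρ` of `u x`, the LF estimator at `q ± M * ρ` errs by
  -- at most a further `M₁ * ρ`, and the extra `1` gives strict inequality.
  set M := (2 * M₁ + M₂ + 1) / cL with hM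
  have hMpos : 0 < M := by positivity
  have hcM : cL * M = 2 * M₁ + M₂ + 1 := by rw [hM]; field_simp
  have hMρ : Tendsto (fun k => M * ρ k) atTop (𝓝 0) := by simpa using hρ_lim.const_mul M
  have hM'ρ : Tendsto (fun k => (M₁ + M₂) * ρ k) atTop (𝓝 0) := by
    simpa using hρ_lim.const_mul (M₁ + M₂)
  have hn_lim : Tendsto (fun k => (nL k : ℝ)⁻¹) atTop (𝓝 0) :=
    tendsto_inv_atTop_zero.comp (tendsto_natCast_atTop_atTop.comp hnL)
  have htail_lim : Tendsto (fun k => 2 * ((nL k : ℝ) ^ 2)⁻¹) atTop (𝓝 0) := by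
    simpa using (hn_lim.pow 2).const_mul 2
  refine ⟨M, hMpos, ?_⟩
  filter_upwards [htail, hlevel, hbad, hs0, hs_inv, hnL.eventually_gt_atTop 0,
    hMρ.eventually (gt_mem_nhds (sub_pos.2 hqIoo.1)),
    hMρ.eventually (gt_mem_nhds (sub_pos.2 hqIoo.2)),
    -- Keeps the estimated level positive, as inversion of the LF estimator requires.
    hM'ρ.eventually (gt_mem_nhds (hlink x hx).1.1), htail_lim.eventually (gt_mem_nhds hε5)]
    with k htk hlk hbk hsk hsi hnk hlo hhi hu0 hεk
  have hρ0 : 0 < ρ k := by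
    have : (0 : ℝ) < (nL k : ℝ)⁻¹ := inv_pos.2 (Nat.cast_pos.2 hnk)
    exact add_pos_of_nonneg_of_pos (hr0 k) (this.trans_le hsi)
  have hsρ : s k ≤ ρ k := le_add_of_nonneg_left (hr0 k)
  have hMk : 0 < M * ρ k := mul_pos hMpos hρ0
  have hup : q + M * ρ k ∈ Icc a b := ⟨by linarith [hqIoo.1], by linarith⟩
  have hdn : q - M * ρ k ∈ Icc a b := ⟨by linarith, by linarith [hqIoo.2]⟩
  have hP₁ := (htk x hx _ hup).trans hεk.le
  have hP₂ := (htk x hx _ hdn).trans hεk.le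
  have hsum : ε = ε / 5 + ε / 5 + ε / 5 + ε / 5 + ε / 5 := by ring
  rw [hsum]
  refine le_trans ?_ (add_le_add (add_le_add (add_le_add (add_le_add hlk.1 hlk.2) hbk) hP₁) hP₂)
  refine le_trans (measureReal_mono ?_ (by finiteness)) ((measureReal_union_le _ _).trans
    (add_le_add_left ((measureReal_union_le _ _).trans (add_le_add_left
      ((measureReal_union_le _ _).trans (add_le_add_left (measureReal_union_le _ _) _)) _)) _))
  intro ω hω
  by_contra hcon
  simp only [mem_union, mem_ofPred_eq, not_or, not_le, not_lt] at hcon hω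
  obtain ⟨⟨⟨⟨hc₁, hc₂⟩, hc₃⟩, hc₄⟩, hc₅⟩ := hcon
  have hu₁ := lt_nwCDF_of_sum_neg (K := K) (h := hu k) (n := nH k) (X := fun i => XH i ω)
    (Z := fun i => nwCDF K (hl k) (nL k) (fun j => XL j ω) (fun j => YL j ω) (XH i ω) (YH i ω))
    (x := x) hK.nonneg (hu_pos k) (sum_neg_of_perturb_upper hK.nonneg (hu_pos k) hc₁ hc₃.le)
  have hu₂ := nwCDF_lt_of_sum_neg (K := K) (h := hu k) (n := nH k) (X := fun i => XH i ω)
    (Z := fun i => nwCDF K (hl k) (nL k) (fun j => XL j ω) (fun j => YL j ω) (XH i ω) (YH i ω))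
    (x := x) hK.nonneg (hu_pos k) (sum_neg_of_perturb_lower hK.nonneg (hu_pos k) hc₂ hc₃.le)
  -- The estimated level lies between `u x - M₂ * ρ k - M₁ * s k` and `u x + M₂ * ρ k + M₁ * s k`.
  have hlev := genInv_nwCDF_mem_Icc hK.nonneg (hu_pos k) hτ.1 hu₂ hu₁.le
  have hg₁ := (hdensL x hx).mul_sub_le hqIcc hup (by linarith)
  have hg₂ := (hdensL x hx).mul_sub_le hdn hqIcc (by linarith)
  rw [hFL, add_sub_cancel_left, ← mul_assoc, hcM] at hg₁
  rw [hFL, sub_sub_cancel, ← mul_assoc, hcM] at hg₂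
  have hM₁s : M₁ * s k ≤ M₁ * ρ k := mul_le_mul_of_nonneg_left hsρ hM₁.le
  have hc₄' := (abs_le.1 hc₄).1
  have hc₅' := (abs_le.1 hc₅).2
  have hquant := genInv_nwCDF_mem_Icc (n := nL k) (X := fun j => XL j ω) (Z := fun j => YL j ω) (x := x)
    (z₁ := q - M * ρ k) (z₂ := q + M * ρ k) hK.nonneg (hl_pos k)
    (lt_of_lt_of_le (by linarith) hlev.1) (lt_of_lt_of_le (by linarith) hlev.1)
    (hlev.2.trans (by linarith))
  refine absurd hω (not_lt.2 (abs_le.2 ⟨?_, ?_⟩))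
  · unfold wrapperEstimator kernelQuantile
    linarith [hquant.1]
  · unfold wrapperEstimator kernelQuantile
    linarith [hquant.2]

end Rates

end MFQR

theorem mainTheorem1 {Ω : Type*} [MeasurableSpace Ω] (P : Measure Ω) [IsProbabilityMeasure P]
    (p : ℕ) (hp : 1 ≤ p) (𝒳 : Set (MFQR.Cov p))
    (τ : ℝ) (hτ : τ ∈ Ioo (0 : ℝ) 1)
    -- conditional laws of the HF and LF responses given the covariate
    (κH κL : Kernel (MFQR.Cov p) ℝ) [IsMarkovKernel κH] [IsMarkovKernel κL]
    (u : MFQR.Cov p → ℝ) (a b ul ur : ℝ)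
    (hlink : MFQR.LocalQuantileLink 𝒳 τ κH κL u)
    (hreg : MFQR.Regularity 𝒳 τ κH κL u a b ul ur)
    (βq βu βL : ℝ) (hβq : βq ∈ Ioc (0 : ℝ) 1) (hβu : βu ∈ Ioc (0 : ℝ) 1)
    (hβL : βL ∈ Ioc (0 : ℝ) 1)
    (hsmooth : MFQR.Smoothness 𝒳 τ κH κL u a b ul ur βq βu βL)
    -- covariate densities and smoothing kernel
    (fH fL : MFQR.Cov p → ℝ)
    (hfH : MFQR.DensityBounds 𝒳 fH) (hfL : MFQR.DensityBounds 𝒳 fL)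
    (K : MFQR.Cov p → ℝ) (hK : MFQR.KernelConditions K) (hmass : MFQR.KernelMass 𝒳 K)
    -- independent HF and LF samples
    (XH XL : ℕ → Ω → MFQR.Cov p) (YH YL : ℕ → Ω → ℝ)
    (hH : MFQR.IsIIDSample P XH YH (MFQR.designLaw 𝒳 fH) κH)
    (hL : MFQR.IsIIDSample P XL YL (MFQR.designLaw 𝒳 fL) κL)
    (hHL : IndepFun (fun ω i => (XH i ω, YH i ω)) (fun ω j => (XL j ω, YL j ω)) P)
    -- sample sizes and bandwidths
    (nH nL : ℕ → ℕ) (hnH : Tendsto nH atTop atTop) (hnL : Tendsto nL atTop atTop)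
    (hq hu hl : ℕ → ℝ) (hq_pos : ∀ k, 0 < hq k) (hu_pos : ∀ k, 0 < hu k) (hl_pos : ∀ k, 0 < hl k)
    (hq_rate : hq =Θ[atTop] fun k => (nH k : ℝ) ^ (-(1 / (2 * βq + p))))
    (hu_rate : hu =Θ[atTop] fun k => (nH k : ℝ) ^ (-(1 / (2 * βu + p))))
    (hl_rate : hl =Θ[atTop] fun k => (Real.log (nL k) / nL k) ^ (1 / (2 * βL + p)))
    (x : MFQR.Cov p) (hx : x ∈ 𝒳) :
    MFQR.IsBigOp P
      (fun k ω => MFQR.kernelQuantile K (hq k) (nH k) (fun i => XH i ω) (fun i => YH i ω) τ x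
        - MFQR.condQuantile κH x τ)
      (fun k => (nH k : ℝ) ^ (-(βq / (2 * βq + p)))) ∧
    MFQR.IsBigOp P
      (fun k ω => MFQR.wrapperEstimator K (hu k) (hl k) (nH k) (nL k)
          (fun i => XH i ω) (fun i => YH i ω) (fun j => XL j ω) (fun j => YL j ω) τ x
        - MFQR.condQuantile κH x τ)
      (fun k => (nH k : ℝ) ^ (-(βu / (2 * βu + p)))
        + (Real.log (nL k) / nL k) ^ (βL / (2 * βL + p))) := by
  exact ⟨MFQR.kernelQuantile_isBigOp hτ hreg hβq.1 hsmooth hfH hK hmass hH hnH hq_pos hq_rate hx,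
    MFQR.wrapperEstimator_isBigOp hτ hlink hreg hβu.1 hβL.1 hsmooth hfH hfL hK hmass hH hL hHL
      hnH hnL hu_pos hl_pos hu_rate hl_rate hx⟩
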